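/- Let $G$ be a (Hausdorff, real, smooth) Lie group of finite dimension $d$ with neutral element $e$ and Lie algebra $\mathfrak g$. Let $\mathcal F(G)$ be the space of all real-valued functions on $G$, and $C_c^\infty(G)$ the space of smooth real-valued functions on $G$ with compact support. Fix a basis $X_1,\dots,X_d$ of $\mathfrak g$; the $X_i$ act on smooth functions as left-invariant vector fields. A *canonical co-ordinate neighbourhood* of $e$ (with respect to $X_1,\dots,X_d$) is an open set $U\ni e$ together with functions $x_1,\dots,x_d\in C_c^\infty(G)$ such that $x_i(e)=0$ for all $i$ and $g\mapsto(x_1(g),\dots,x_d(g))$ maps $U$ homeomorphically onto an open subset of $\mathbb R^d$, with inverse $u\mapsto\exp(\sum_i u_iX_i)$. Fix one such $U$ and $x_1,\dots,x_d$. A *Lévy measure* on $G$ is a Borel measure $\nu$ with $\nu(\{e\})=0$ such that for every canonical co-ordinate neighbourhood $U'$ of $e$, with co-ordinates $x_1',\dots,x_d'$, $$\int_{U'}\sum_{i=1}^d x_i'(\tau)^2\,\nu(d\tau)<\infty\quad\text{and}\quad \nu(G\setminus U')<\infty .$$ A *Lévy kernel* is a family $\mu(\sigma,\cdot)$, $\sigma\in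 G$, of Lévy measures on $G$. A linear map $A:C_c^\infty(G)\to\mathcal F(G)$ satisfies the *positive maximum principle* if, whenever $f\in C_c^\infty(G)$ and $\rho\in G$ satisfy $f(\rho)=\sup_{\tau\in G}f(\tau)\ge 0$, then $Af(\rho)\le 0$. **Theorem (generalised Courrège theorem).** For every Lévy measure $\nu$, $f\in C_c^\infty(G)$ and $\sigma\in G$, the function $\tau\mapsto f(\sigma\tau)-f(\sigma)-\sum_{i=1}^d x_i(\tau)X_if(\sigma)$ is $\nu$-integrable. A linear map $A:C_c^\infty(G)\to\mathcal F(G)$ satisfies the positive maximum principle if and only if there exist functions $c,b_i,a_{jk}:G\to\mathbb R$ ($1\le i,j,k\le d$), with $c\ge 0$ and with the matrix $a(\sigma)=(a_{jk}(\sigma))$ symmetric and non-negative definite for every $\sigma\in G$, and a Lévy kernel $\mu$, such that for all $f\in C_c^\infty(G)$ and $\sigma\in G$, $$Af(\sigma)=-c(\sigma)f(\sigma)+\sum_{i=1}^d b_i(\sigma)X_if(\sigma)+\sum_{j,k=1}^d a_{jk}(\sigma)X_jX_kf(\sigma)+\int_G\Big(f(\sigma\tau)-f(\sigma)-\sum_{i=1}^d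 x_i(\tau)X_if(\sigma)\Big)\mu(\sigma,d\tau).$$ -/

import Mathlib

open scoped Manifold ContDiff
open MeasureTheory Set

/-! ### Smooth functions of compact support on a Lie group, and left-invariant vector fields -/

section LieGroupBasics

variable {d : ℕ} {G : Type*} [TopologicalSpace G] [ChartedSpace (EuclideanSpace ℝ (Fin d)) G]

/-- `C_c^∞(G)`: the real vector space of smooth real-valued functions on `G` (a manifold of
dimension `d`) that have compact support. -/
def smoothCompSupp (d : ℕ) (G : Type*) [TopologicalSpace G]
    [ChartedSpace (EuclideanSpace ℝ (Fin d)) G] : Submodule ℝ (G → ℝ) where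
  carrier := {f | ContMDiff (𝓡 d) 𝓘(ℝ, ℝ) ∞ f ∧ HasCompactSupport f}
  add_mem' hf hg := ⟨hf.1.add hg.1, hf.2.add hg.2⟩
  zero_mem' := ⟨contMDiff_const, HasCompactSupport.zero⟩
  smul_mem' r _ hf := ⟨contMDiff_const.mul (I' := 𝓡 d) hf.1, hf.2.mul_left (f := fun _ => r)⟩

variable [Group G]

/-- The action of an element `v` of the Lie algebra of `G` on functions, as a left-invariant
vector field: `(v f)(g)` is the derivative of `f` at `g` in the direction of the value at `g` of the
left-invariant vector field that extends `v`. -/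
noncomputable def invDeriv (v : GroupLieAlgebra (𝓡 d) G) (f : G → ℝ) (g : G) : ℝ :=
  mfderiv (𝓡 d) 𝓘(ℝ, ℝ) f g (mulInvariantVectorField v g)

/-- For every `v` in the Lie algebra there is a globally defined integral curve, starting at the
neutral element, of the left-invariant vector field that extends `v` (it is unique, and it is the
one-parameter subgroup with velocity `v` at time `0`). -/
theorem exists_lieCurve [T2Space G] [LieGroup (𝓡 d) ∞ G] (v : GroupLieAlgebra (𝓡 d) G) :
    ∃ γ : ℝ → G, γ 0 = 1 ∧ IsMIntegralCurve (I := 𝓡 d) γ (mulInvariantVectorField v) := by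
  have : LieGroup (𝓡 d) (minSmoothness ℝ 3) G := by
    rw [minSmoothness_of_isRCLikeNormedField]
    exact LieGroup.of_le (n := ∞) (ENat.LEInfty.out)
  have : IsManifold (𝓡 d) 1 G := IsManifold.of_le (n := ∞) (by exact_mod_cast le_top)
  have hv : ContMDiff (𝓡 d) (𝓡 d).tangent 1
      (fun g : G => (mulInvariantVectorField v g : TangentBundle (𝓡 d) G)) :=
    (contMDiff_mulInvariantVectorField v).of_le
      (by rw [minSmoothness_of_isRCLikeNormedField]; norm_num)
  have hmul : ∀ g : G, MDifferentiable (𝓡 d) (𝓡 d) (fun h : G => g * h) := fun g =>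
    (contMDiff_mul_left (I := 𝓡 d) (n := ∞) (a := g)).mdifferentiable (by simp)
  obtain ⟨γ, hγ0, hγ⟩ := exists_isMIntegralCurveAt_of_contMDiffAt_boundaryless (I := 𝓡 d)
    (v := mulInvariantVectorField v) (x₀ := (1 : G)) 0 hv.contMDiffAt
  obtain ⟨ε, hε, hγ⟩ := isMIntegralCurveAt_iff'.1 hγ
  refine exists_isMIntegralCurve_of_isMIntegralCurveOn hv hε (fun g => ?_) 1
  refine ⟨fun t => g * γ t, by simp [hγ0], fun t ht => ?_⟩
  have h1 := hγ t (by simpa [Real.ball_eq_Ioo] using ht)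
  have h2 := ((hmul g) (γ t)).hasMFDerivAt.comp_hasMFDerivWithinAt t h1
  rw [Real.ball_eq_Ioo, zero_sub, zero_add] at h2
  have key : mulInvariantVectorField v (g * γ t) =
      mfderiv (𝓡 d) (𝓡 d) (fun h : G => g * h) (γ t) (mulInvariantVectorField v (γ t)) := by
    have hcomp : (fun h : G => g * γ t * h) = (fun h : G => g * h) ∘ fun h : G => γ t * h := by
      funext h; simp [mul_assoc]
    have h3 : HasMFDerivAt (𝓡 d) (𝓡 d) (fun h : G => g * h) (γ t * 1)
        (mfderiv (𝓡 d) (𝓡 d) (fun h : G => g * h) (γ t)) := by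
      rw [mul_one]; exact ((hmul g) (γ t)).hasMFDerivAt
    have h4 := (h3.comp (1 : G) ((hmul (γ t)) 1).hasMFDerivAt).mfderiv
    rw [← hcomp] at h4
    exact congrArg (fun L : EuclideanSpace ℝ (Fin d) →L[ℝ] EuclideanSpace ℝ (Fin d) => L v) h4
  have h5 : (mfderiv (𝓡 d) (𝓡 d) (fun h : G => g * h) (γ t)).comp
      (ContinuousLinearMap.smulRight (1 : ℝ →L[ℝ] ℝ) (mulInvariantVectorField v (γ t))) =
      ContinuousLinearMap.smulRight (1 : ℝ →L[ℝ] ℝ) (mulInvariantVectorField v (g * γ t)) := by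
    rw [key]
    exact ContinuousLinearMap.ext fun s => ContinuousLinearMap.map_smul
      (mfderiv (𝓡 d) (𝓡 d) (fun h : G => g * h) (γ t)) s (mulInvariantVectorField v (γ t))
  exact h5 ▸ h2

/-- The exponential map of `G`: `lieExp v = γ 1`, where `γ` is the integral curve through the
neutral element of the left-invariant vector field that extends `v`, i.e. the one-parameter subgroup
with velocity `v` at time `0`. -/
noncomputable def lieExp [T2Space G] [LieGroup (𝓡 d) ∞ G] (v : GroupLieAlgebra (𝓡 d) G) : G :=
  (exists_lieCurve v).choose 1

/-- `U` is a canonical co-ordinate neighbourhood of the neutral element, with canonical co-ordinates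
`x₁, …, x_d` (of the first kind, with respect to the basis `X` of the Lie algebra): on the open set
`U`, the map `x = (x₁, …, x_d)` is a homeomorphism onto an open subset of `ℝ^d` with
`x(e) = 0` and inverse `u ↦ exp (∑ uᵢ Xᵢ)`. As usual, the `xᵢ` are taken
to be (restrictions to `U` of) functions in `C_c^∞(G)`. -/
structure IsCanonicalCoords [T2Space G] [LieGroup (𝓡 d) ∞ G]
    (X : Module.Basis (Fin d) ℝ (GroupLieAlgebra (𝓡 d) G))
    (U : Set G) (x : Fin d → G → ℝ) : Prop where
  isOpen : IsOpen U
  one_mem : (1 : G) ∈ U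
  mem_smoothCompSupp : ∀ i, x i ∈ smoothCompSupp d G
  isOpen_image : IsOpen ((fun (g : G) (i : Fin d) => x i g) '' U)
  map_one : ∀ i, x i 1 = 0
  exp_coords : ∀ g ∈ U, lieExp (∑ i, x i g • X i) = g

/-- A Lévy measure on `G`: a Borel measure `μ` that does not charge the neutral element and
such that `∫_U ∑ xᵢ² dμ < ∞` and `μ(Uᶜ) < ∞` for every canonical co-ordinate neighbourhood `U` of
the neutral element. -/
structure IsLevyMeasure [T2Space G] [LieGroup (𝓡 d) ∞ G] [MeasurableSpace G]
    (X : Module.Basis (Fin d) ℝ (GroupLieAlgebra (𝓡 d) G)) (μ : Measure G) : Prop where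
  singleton_one : μ {1} = 0
  lintegral_lt_top : ∀ (U : Set G) (x : Fin d → G → ℝ), IsCanonicalCoords X U x →
    ∫⁻ g in U, ENNReal.ofReal (∑ i, x i g ^ 2) ∂μ < ⊤
  compl_lt_top : ∀ (U : Set G) (x : Fin d → G → ℝ), IsCanonicalCoords X U x → μ Uᶜ < ⊤

/-- The positive maximum principle for a linear operator from `C_c^∞(G)` to real functions on
`G`: if `f` attains a non-negative global maximum at `ρ` then `(A f)(ρ) ≤ 0`. -/
def PositiveMaximumPrinciple (A : smoothCompSupp d G →ₗ[ℝ] (G → ℝ)) : Prop :=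
  ∀ (f : smoothCompSupp d G) (ρ : G),
    (∀ τ : G, (f : G → ℝ) τ ≤ (f : G → ℝ) ρ) → 0 ≤ (f : G → ℝ) ρ → A f ρ ≤ 0

end LieGroupBasics

/-! ### Left-invariant derivatives, and Taylor bounds on the real line. -/

section InvariantDerivatives

open Bundle Filter Topology

variable {d : ℕ} {G : Type*} [TopologicalSpace G] [ChartedSpace (EuclideanSpace ℝ (Fin d)) G]
  [Group G]

/-! Left translation commutes with the fields `X i`, so everything reduces to one linear functional
`T` on `C_c^∞(G)` satisfying the positive maximum principle at the neutral element `1`; for the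
operator it is `f ↦ A (f(σ⁻¹ ·)) σ`.

Applied to `-f`, the principle makes `T` non-negative on non-negative functions vanishing at `1`.
Let `φ` be a cut-off at `1` and let `q = ∑ xᵢ² + (1 - φ)`, which vanishes only at `1`. Then `f ↦ T
(f q)` is positive and bounded for the uniform norm, hence is integration against a finite regular
measure `m` (`exists_positive_extension`, `exists_regular_measure_of_bounded`). The Lévy measure is
`ν = q⁻¹ m` off `1`, and `T h = ∫ h dν` whenever `h` vanishes near `1` (`exists_measure`).

Let `S` be `T` minus the `ν`-integral of the first-order Taylor remainder. `S` kills functions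
vanishing near `1`, and is non-negative on functions that vanish at `1` and are non-negative near
`1` (`levyIntegral_le_map_of_eventually`). If `r` vanishes to third order, then `|r| ≤ ε ∑ xᵢ²` near
`1`, so `|S r| ≤ ε S (∑ xᵢ²)` for every `ε > 0` and `S r = 0` (`map_eq_levyIntegral_of_cubic`).
Hence `S f` depends only on the second-order Taylor polynomial of `f`, with coefficients `c = -S φ`,
`bᵢ = S xᵢ` and `a_{jk} = S (x_j x_k) / 2`. The matrix is non-negative because `S ((∑ ξ_j x_j)²) ≥
0`, and `c ≥ 0` is the estimate `∫ (1 - φ) dν ≤ -T φ`.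

Conversely, at a non-negative maximum the first derivatives vanish, the integrand is non-positive,
and the second-order part is a sum of second derivatives along one-parameter subgroups, each
non-positive. -/

theorem tsupport_invDeriv_subset (v : GroupLieAlgebra (𝓡 d) G) (f : G → ℝ) :
    tsupport (invDeriv v f) ⊆ tsupport f := by
  refine closure_minimal (fun g hg => ?_) (isClosed_tsupport f)
  by_contra h
  apply hg
  have h0 : f =ᶠ[𝓝 g] fun _ => (0 : ℝ) := notMem_tsupport_iff_eventuallyEq.1 h
  have : mfderiv (𝓡 d) 𝓘(ℝ, ℝ) f g = 0 := by
    rw [h0.mfderiv_eq, mfderiv_const]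
    rfl
  change mfderiv (𝓡 d) 𝓘(ℝ, ℝ) f g (mulInvariantVectorField v g) = 0
  rw [this]; rfl

theorem invDeriv_add_vector (v w : GroupLieAlgebra (𝓡 d) G) (f : G → ℝ) (g : G) :
    invDeriv (v + w) f g = invDeriv v f g + invDeriv w f g := by
  simp only [invDeriv, mulInvariantVectorField_add]
  exact map_add (mfderiv (𝓡 d) 𝓘(ℝ, ℝ) f g) _ _

theorem invDeriv_smul_vector (r : ℝ) (v : GroupLieAlgebra (𝓡 d) G) (f : G → ℝ) (g : G) :
    invDeriv (r • v) f g = r * invDeriv v f g := by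
  simp only [invDeriv, mulInvariantVectorField_smul]
  exact map_smul (mfderiv (𝓡 d) 𝓘(ℝ, ℝ) f g) _ _

theorem invDeriv_sum_smul_vector {ι : Type*} (s : Finset ι) (r : ι → ℝ)
    (v : ι → GroupLieAlgebra (𝓡 d) G) (f : G → ℝ) (g : G) :
    invDeriv (∑ i ∈ s, r i • v i) f g = ∑ i ∈ s, r i * invDeriv (v i) f g := by
  classical
  induction s using Finset.induction_on with
  | empty =>
    have := invDeriv_smul_vector 0 (0 : GroupLieAlgebra (𝓡 d) G) f g
    simpa using this
  | insert a s ha ih =>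
    rw [Finset.sum_insert ha, Finset.sum_insert ha, invDeriv_add_vector, invDeriv_smul_vector, ih]

theorem invDeriv_add (v : GroupLieAlgebra (𝓡 d) G) {f h : G → ℝ}
    (hf : ContMDiff (𝓡 d) 𝓘(ℝ, ℝ) ∞ f) (hh : ContMDiff (𝓡 d) 𝓘(ℝ, ℝ) ∞ h) (g : G) :
    invDeriv v (fun τ => f τ + h τ) g = invDeriv v f g + invDeriv v h g := by
  have h1 := mfderiv_add ((hf g).mdifferentiableAt (by simp)) ((hh g).mdifferentiableAt (by simp))
  exact congrArg (fun L : EuclideanSpace ℝ (Fin d) →L[ℝ] ℝ => L (mulInvariantVectorField v g)) h1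

theorem invDeriv_const_mul (v : GroupLieAlgebra (𝓡 d) G) (r : ℝ) {f : G → ℝ}
    (hf : ContMDiff (𝓡 d) 𝓘(ℝ, ℝ) ∞ f) (g : G) :
    invDeriv v (fun τ => r * f τ) g = r * invDeriv v f g := by
  have h1 := const_smul_mfderiv ((hf g).mdifferentiableAt (by simp)) r
  exact congrArg (fun L : EuclideanSpace ℝ (Fin d) →L[ℝ] ℝ => L (mulInvariantVectorField v g)) h1

theorem invDeriv_sum {ι : Type*} (s : Finset ι) (v : GroupLieAlgebra (𝓡 d) G) {f : ι → G → ℝ}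
    (hf : ∀ i, ContMDiff (𝓡 d) 𝓘(ℝ, ℝ) ∞ (f i)) (g : G) :
    invDeriv v (fun τ => ∑ i ∈ s, f i τ) g = ∑ i ∈ s, invDeriv v (f i) g := by
  classical
  induction s using Finset.induction_on with
  | empty =>
    have := invDeriv_const_mul v 0 (f := fun _ => 0) contMDiff_const g
    simpa using this
  | insert a s ha ih =>
    simp only [Finset.sum_insert ha]
    rw [invDeriv_add v (hf a) (contMDiff_finsetSum fun i _ => hf i), ih]

theorem hasDerivAt_comp_integralCurve {v : GroupLieAlgebra (𝓡 d) G} {γ : ℝ → G}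
    (hγ : IsMIntegralCurve (I := 𝓡 d) γ (mulInvariantVectorField v)) {f : G → ℝ}
    (hf : ContMDiff (𝓡 d) 𝓘(ℝ, ℝ) ∞ f) (t : ℝ) :
    HasDerivAt (fun s => f (γ s)) (invDeriv v f (γ t)) t := by
  have h1 : HasMFDerivAt 𝓘(ℝ, ℝ) 𝓘(ℝ, ℝ) (fun s => f (γ s)) t _ :=
    ((hf (γ t)).mdifferentiableAt (by simp)).hasMFDerivAt.comp t (hγ t)
  let L : ℝ →L[ℝ] ℝ := ContinuousLinearMap.comp
    (mfderiv (𝓡 d) 𝓘(ℝ, ℝ) f (γ t) : EuclideanSpace ℝ (Fin d) →L[ℝ] ℝ)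
    (ContinuousLinearMap.smulRight (1 : ℝ →L[ℝ] ℝ)
      (mulInvariantVectorField v (γ t) : EuclideanSpace ℝ (Fin d)))
  have h2 : HasFDerivAt (fun s => f (γ s)) L t := hasMFDerivAt_iff_hasFDerivAt.1 h1
  have h3 : L 1 = invDeriv v f (γ t) := by
    refine congrArg
      (fun w => (mfderiv (𝓡 d) 𝓘(ℝ, ℝ) f (γ t) : EuclideanSpace ℝ (Fin d) →L[ℝ] ℝ) w) ?_
    exact one_smul ℝ (mulInvariantVectorField v (γ t) : EuclideanSpace ℝ (Fin d))
  exact h3 ▸ h2.hasDerivAt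

variable [LieGroup (𝓡 d) ∞ G]

theorem mdifferentiable_mul_left_lie (g : G) :
    MDifferentiable (𝓡 d) (𝓡 d) (fun h : G => g * h) :=
  (contMDiff_mul_left (I := 𝓡 d) (n := ∞) (a := g)).mdifferentiable (by simp)

/-- On a `C^∞` Lie group, left-invariant vector fields are `C^∞`. -/
theorem contMDiff_infty_mulInvariantVectorField (v : GroupLieAlgebra (𝓡 d) G) :
    ContMDiff (𝓡 d) (𝓡 d).tangent ∞
      (fun g : G => (mulInvariantVectorField v g : TangentBundle (𝓡 d) G)) := by
  have : IsManifold (𝓡 d) (∞ + 1) G := inferInstanceAs (IsManifold (𝓡 d) ∞ G)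
  -- The field is `g ↦ D(mul)_{(g,1)} (0, v)`, so its smoothness is inherited from the tangent map
  -- of multiplication.
  let fg : G → TangentBundle (𝓡 d) G := fun g ↦ TotalSpace.mk' (EuclideanSpace ℝ (Fin d)) g 0
  have sfg : ContMDiff (𝓡 d) (𝓡 d).tangent ∞ fg := contMDiff_zeroSection _ _
  let fv : G → TangentBundle (𝓡 d) G := fun _ ↦ TotalSpace.mk' (EuclideanSpace ℝ (Fin d)) 1 v
  have sfv : ContMDiff (𝓡 d) (𝓡 d).tangent ∞ fv := contMDiff_const
  let F₁ : G → (TangentBundle (𝓡 d) G × TangentBundle (𝓡 d) G) := fun g ↦ (fg g, fv g)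
  have S₁ : ContMDiff (𝓡 d) ((𝓡 d).tangent.prod (𝓡 d).tangent) ∞ F₁ := sfg.prodMk sfv
  let F₂ : (TangentBundle (𝓡 d) G × TangentBundle (𝓡 d) G) →
      TangentBundle ((𝓡 d).prod (𝓡 d)) (G × G) :=
    (equivTangentBundleProd (𝓡 d) G (𝓡 d) G).symm
  have S₂ : ContMDiff ((𝓡 d).tangent.prod (𝓡 d).tangent) ((𝓡 d).prod (𝓡 d)).tangent ∞ F₂ :=
    contMDiff_equivTangentBundleProd_symm
  let F₃ : TangentBundle ((𝓡 d).prod (𝓡 d)) (G × G) → TangentBundle (𝓡 d) G :=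
    tangentMap ((𝓡 d).prod (𝓡 d)) (𝓡 d) (fun (p : G × G) ↦ p.1 * p.2)
  have S₃ : ContMDiff ((𝓡 d).prod (𝓡 d)).tangent (𝓡 d).tangent ∞ F₃ :=
    ContMDiff.contMDiff_tangentMap (n := ∞) (contMDiff_mul (𝓡 d) ∞) (m := ∞) le_rfl
  let S := (S₃.comp S₂).comp S₁
  convert! S with g
  · simp [F₁, F₂, F₃, fg, fv]
  · simp only [Function.comp_apply, tangentMap, F₃, F₂, F₁, fg, fv]
    rw [mfderiv_prod_eq_add_apply ((contMDiff_mul (𝓡 d) ∞).mdifferentiableAt (by simp))]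
    have h0 : (mfderiv (𝓡 d) (𝓡 d) (fun z : G => z * 1) g :
        EuclideanSpace ℝ (Fin d) →L[ℝ] EuclideanSpace ℝ (Fin d)) 0 = 0 := map_zero _
    let w : EuclideanSpace ℝ (Fin d) := mulInvariantVectorField v g
    exact (zero_add w).symm.trans (congrArg (· + w) h0.symm)

theorem contMDiff_invDeriv (v : GroupLieAlgebra (𝓡 d) G) {f : G → ℝ}
    (hf : ContMDiff (𝓡 d) 𝓘(ℝ, ℝ) ∞ f) : ContMDiff (𝓡 d) 𝓘(ℝ, ℝ) ∞ (invDeriv v f) := by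
  have : IsManifold (𝓡 d) 1 G := IsManifold.of_le (n := ∞) (by exact_mod_cast le_top)
  have h1 : ContMDiff (𝓡 d).tangent 𝓘(ℝ, ℝ).tangent ∞ (tangentMap (𝓡 d) 𝓘(ℝ, ℝ) f) :=
    hf.contMDiff_tangentMap (m := ∞) le_rfl
  have h2 := h1.comp (contMDiff_infty_mulInvariantVectorField v)
  exact (contMDiff_snd_tangentBundle_modelSpace ℝ 𝓘(ℝ, ℝ)).comp h2

theorem invDeriv_mem_smoothCompSupp (v : GroupLieAlgebra (𝓡 d) G) {f : G → ℝ}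
    (hf : f ∈ smoothCompSupp d G) : invDeriv v f ∈ smoothCompSupp d G :=
  ⟨contMDiff_invDeriv v hf.1, hf.2.of_isClosed_subset (isClosed_tsupport _)
    (tsupport_invDeriv_subset v f)⟩

/-- Chain rule for `L_{σg} = L_σ ∘ L_g` at `1`. -/
theorem mulInvariantVectorField_mul (v : GroupLieAlgebra (𝓡 d) G) (σ g : G) :
    mulInvariantVectorField v (σ * g) =
      mfderiv (𝓡 d) (𝓡 d) (fun h : G => σ * h) g (mulInvariantVectorField v g) := by
  have hcomp : (fun h : G => σ * g * h) = (fun h : G => σ * h) ∘ fun h : G => g * h := by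
    funext h; simp [mul_assoc]
  have h3 : HasMFDerivAt (𝓡 d) (𝓡 d) (fun h : G => σ * h) (g * 1)
      (mfderiv (𝓡 d) (𝓡 d) (fun h : G => σ * h) g) := by
    rw [mul_one]; exact ((mdifferentiable_mul_left_lie σ) g).hasMFDerivAt
  have h4 := (h3.comp (1 : G) ((mdifferentiable_mul_left_lie g) 1).hasMFDerivAt).mfderiv
  rw [← hcomp] at h4
  exact congrArg (fun L : EuclideanSpace ℝ (Fin d) →L[ℝ] EuclideanSpace ℝ (Fin d) => L v) h4

theorem invDeriv_comp_mul_left (v : GroupLieAlgebra (𝓡 d) G) {f : G → ℝ}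
    (hf : ContMDiff (𝓡 d) 𝓘(ℝ, ℝ) ∞ f) (σ : G) :
    invDeriv v (fun τ => f (σ * τ)) = fun τ => invDeriv v f (σ * τ) := by
  funext g
  have h1 := mfderiv_comp g ((hf (σ * g)).mdifferentiableAt (by simp))
    (mdifferentiable_mul_left_lie σ g)
  have h2 := congrArg
    (fun L : EuclideanSpace ℝ (Fin d) →L[ℝ] ℝ => L (mulInvariantVectorField v g)) h1
  refine h2.trans ?_
  unfold invDeriv
  rw [mulInvariantVectorField_mul]
  rfl

theorem comp_mul_left_mem_smoothCompSupp {f : G → ℝ} (hf : f ∈ smoothCompSupp d G) (σ : G) :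
    (fun τ => f (σ * τ)) ∈ smoothCompSupp d G := by
  have := topologicalGroup_of_lieGroup (𝓡 d) (n := ∞) (G := G)
  exact ⟨hf.1.comp (contMDiff_mul_left (I := 𝓡 d) (n := ∞) (a := σ)),
    hf.2.comp_homeomorph (Homeomorph.mulLeft σ)⟩

/-- The mean value inequality on `[0, 1]`, where the factor `t ≤ 1` is dropped. Returning the same
bound `K` lets it be iterated, at the price of the factorials in Taylor's formula, which are not
needed. -/
theorem abs_sub_le_of_hasDerivAt {h h' : ℝ → ℝ} {K : ℝ} (hd : ∀ t, HasDerivAt h (h' t) t)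
    (hK : ∀ t ∈ Icc (0 : ℝ) 1, |h' t| ≤ K) : ∀ t ∈ Icc (0 : ℝ) 1, |h t - h 0| ≤ K := by
  intro t ht
  have hK0 : 0 ≤ K := (abs_nonneg _).trans (hK t ht)
  have := (convex_Icc (0 : ℝ) 1).norm_image_sub_le_of_norm_hasDerivWithin_le (f := h)
    (fun s _ => (hd s).hasDerivWithinAt) hK (left_mem_Icc.2 zero_le_one) ht
  refine this.trans ?_
  rw [Real.norm_eq_abs, sub_zero, abs_of_nonneg ht.1]
  exact mul_le_of_le_one_right hK0 ht.2

theorem taylor_one_abs_le {g g1 g2 : ℝ → ℝ} {K : ℝ} (h0 : ∀ t, HasDerivAt g (g1 t) t)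
    (h1 : ∀ t, HasDerivAt g1 (g2 t) t) (hK : ∀ t, |g2 t| ≤ K) : |g 1 - g 0 - g1 0| ≤ K := by
  have := abs_sub_le_of_hasDerivAt (h := fun t => g t - t * g1 0) (h' := fun t => g1 t - g1 0)
    (K := K) (fun t => by simpa using (h0 t).fun_sub ((hasDerivAt_id t).mul_const (g1 0)))
    (abs_sub_le_of_hasDerivAt h1 fun t _ => hK t) 1 (right_mem_Icc.2 zero_le_one)
  convert this using 2
  ring

theorem taylor_two_abs_le {g g1 g2 g3 : ℝ → ℝ} {K : ℝ} (h0 : ∀ t, HasDerivAt g (g1 t) t)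
    (h1 : ∀ t, HasDerivAt g1 (g2 t) t) (h2 : ∀ t, HasDerivAt g2 (g3 t) t)
    (hK : ∀ t, |g3 t| ≤ K) : |g 1 - g 0 - g1 0 - g2 0 / 2| ≤ K := by
  have e1 := abs_sub_le_of_hasDerivAt (h := fun t => g1 t - t * g2 0)
    (h' := fun t => g2 t - g2 0)
    (K := K) (fun t => by simpa using (h1 t).fun_sub ((hasDerivAt_id t).mul_const (g2 0)))
    (abs_sub_le_of_hasDerivAt h2 fun t _ => hK t)
  have := abs_sub_le_of_hasDerivAt (h := fun t => g t - t * g1 0 - t ^ 2 * (g2 0 / 2))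
    (h' := fun t => g1 t - t * g2 0 - (g1 0 - 0 * g2 0))
    (K := K) (fun t => by
      convert! ((h0 t).sub ((hasDerivAt_id t).mul_const (g1 0))).sub
        ((hasDerivAt_pow 2 t).mul_const (g2 0 / 2)) using 1
      simp; ring)
    e1 1 (right_mem_Icc.2 zero_le_one)
  convert this using 2
  ring

end InvariantDerivatives

/-! ### Smooth test functions and cut-offs. -/

section TestFunctions

open Filter Topology

variable {d : ℕ} {G : Type*} [TopologicalSpace G] [ChartedSpace (EuclideanSpace ℝ (Fin d)) G]

theorem exists_abs_le_of_mem_smoothCompSupp {f : G → ℝ} (hf : f ∈ smoothCompSupp d G) :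
    ∃ C, 0 ≤ C ∧ ∀ g, |f g| ≤ C := by
  obtain ⟨C, hC⟩ := hf.2.exists_bound_of_continuous hf.1.continuous
  exact ⟨max C 0, le_max_right _ _, fun g => (hC g).trans (le_max_left _ _)⟩

theorem mul_mem_smoothCompSupp {f h : G → ℝ} (hf : f ∈ smoothCompSupp d G)
    (hh : ContMDiff (𝓡 d) 𝓘(ℝ, ℝ) ∞ h) : (fun g => f g * h g) ∈ smoothCompSupp d G :=
  ⟨hf.1.mul hh, hf.2.mul_right⟩

theorem mul_mem_smoothCompSupp' {f h : G → ℝ} (hf : f ∈ smoothCompSupp d G)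
    (hh : h ∈ smoothCompSupp d G) : (fun g => f g * h g) ∈ smoothCompSupp d G :=
  mul_mem_smoothCompSupp hf hh.1

theorem sum_mem_smoothCompSupp {ι : Type*} (s : Finset ι) {f : ι → G → ℝ}
    (hf : ∀ i, f i ∈ smoothCompSupp d G) : (fun g => ∑ i ∈ s, f i g) ∈ smoothCompSupp d G := by
  have := (smoothCompSupp d G).sum_mem (t := s) (fun i _ => hf i)
  convert this using 1
  ext g; simp

theorem exists_smooth_bump_nhds [T2Space G] [IsManifold (𝓡 d) ∞ G] {c : G} {U : Set G}
    (hU : U ∈ 𝓝 c) :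
    ∃ φ ∈ smoothCompSupp d G, (∀ g, 0 ≤ φ g) ∧ (∀ g, φ g ≤ 1) ∧ (∀ᶠ g in 𝓝 c, φ g = 1) ∧
      tsupport φ ⊆ U := by
  obtain ⟨φ, -, hφ⟩ := (SmoothBumpFunction.nhds_basis_tsupport (I := 𝓡 d) c).mem_iff.1 hU
  exact ⟨φ, ⟨φ.contMDiff, φ.hasCompactSupport⟩, fun g => φ.nonneg, fun g => φ.le_one,
    φ.eventuallyEq_one, hφ⟩

theorem exists_smooth_bump_isCompact [T2Space G] [IsManifold (𝓡 d) ∞ G] {K : Set G}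
    (hK : IsCompact K) :
    ∃ φ ∈ smoothCompSupp d G, (∀ g, 0 ≤ φ g) ∧ (∀ g, φ g ≤ 1) ∧ ∀ g ∈ K, φ g = 1 := by
  refine hK.induction_on (p := fun K => ∃ φ ∈ smoothCompSupp d G,
    (∀ g, 0 ≤ φ g) ∧ (∀ g, φ g ≤ 1) ∧ ∀ g ∈ K, φ g = 1) ?_ ?_ ?_ ?_
  · exact ⟨0, zero_mem _, fun g => le_rfl, fun g => zero_le_one, by simp⟩
  · intro s t hst h
    obtain ⟨φ, h1, h2, h3, h4⟩ := h
    exact ⟨φ, h1, h2, h3, fun g hg => h4 g (hst hg)⟩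
  · intro s t hs ht
    obtain ⟨φ, h1, h2, h3, h4⟩ := hs
    obtain ⟨ψ, k1, k2, k3, k4⟩ := ht
    -- This is `1 - (1 - φ)(1 - ψ)`: it stays in `[0, 1]` and equals `1` wherever `φ` or `ψ` does.
    refine ⟨fun g => φ g + ψ g - φ g * ψ g,
      (smoothCompSupp d G).sub_mem ((smoothCompSupp d G).add_mem h1 k1)
        (mul_mem_smoothCompSupp' h1 k1), fun g => ?_, fun g => ?_, fun g hg => ?_⟩
    · nlinarith [h2 g, h3 g, k2 g, k3 g]
    · nlinarith [h2 g, h3 g, k2 g, k3 g]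
    · rcases hg with hg | hg
      · simp [h4 g hg]
      · simp [k4 g hg]
  · intro c hc
    obtain ⟨φ, h1, h2, h3, h4, -⟩ := exists_smooth_bump_nhds (d := d) (c := c) univ_mem
    exact ⟨_, mem_nhdsWithin_of_mem_nhds h4, φ, h1, h2, h3, fun g hg => hg⟩

end TestFunctions

/-! ### Taylor expansion along one-parameter subgroups, uniform in the direction. -/

section Taylor

/-- The inductive step for iterated derivatives along `∑ uᵢ Xᵢ`: each further derivative is linear
in `u` and raises the power of `∑ |uᵢ|` by one. -/
theorem exists_abs_sum_mul_le {α : Type*} {n : ℕ} {F : Fin n → (Fin n → ℝ) → α → ℝ} {m : ℕ}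
    (hF : ∀ i, ∃ C, 0 ≤ C ∧ ∀ u g, |F i u g| ≤ C * (∑ j, |u j|) ^ m) :
    ∃ C, 0 ≤ C ∧ ∀ u g, |∑ i, u i * F i u g| ≤ C * (∑ j, |u j|) ^ (m + 1) := by
  choose C hC0 hC using hF
  refine ⟨∑ i, C i, Finset.sum_nonneg fun i _ => hC0 i, fun u g => ?_⟩
  have hN : 0 ≤ ∑ j, |u j| := Finset.sum_nonneg fun _ _ => abs_nonneg _
  calc |∑ i, u i * F i u g| ≤ ∑ i, |u i * F i u g| := Finset.abs_sum_le_sum_abs _ _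
    _ ≤ ∑ i, (∑ k, |u k|) * (C i * (∑ j, |u j|) ^ m) := by
        refine Finset.sum_le_sum fun i _ => ?_
        rw [abs_mul]
        refine mul_le_mul (Finset.single_le_sum (f := fun k => |u k|)
          (fun _ _ => abs_nonneg _) (Finset.mem_univ i)) (hC i u g) (abs_nonneg _) hN
    _ = _ := by
        rw [← Finset.mul_sum, ← Finset.sum_mul]; ring

open Filter Topology

variable {d : ℕ} {G : Type*} [TopologicalSpace G] [ChartedSpace (EuclideanSpace ℝ (Fin d)) G]
  [Group G] [LieGroup (𝓡 d) ∞ G]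

theorem invDeriv_invDeriv_sum_smul (X : Fin d → GroupLieAlgebra (𝓡 d) G) (u : Fin d → ℝ)
    (v : GroupLieAlgebra (𝓡 d) G) {f : G → ℝ} (hf : f ∈ smoothCompSupp d G) :
    invDeriv v (invDeriv (∑ i, u i • X i) f) =
      fun g => ∑ i, u i * invDeriv v (invDeriv (X i) f) g := by
  funext g
  have h1 : invDeriv (∑ i, u i • X i) f = fun g => ∑ i, u i * invDeriv (X i) f g :=
    funext fun g => invDeriv_sum_smul_vector _ _ _ _ _
  have h2 : ∀ i, ContMDiff (𝓡 d) 𝓘(ℝ, ℝ) ∞ (invDeriv (X i) f) :=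
    fun i => contMDiff_invDeriv (X i) hf.1
  rw [h1, invDeriv_sum (f := fun i g => u i * invDeriv (X i) f g) Finset.univ v
    (fun i => contMDiff_const.mul (I' := 𝓡 d) (h2 i))]
  exact Finset.sum_congr rfl fun i _ => invDeriv_const_mul v (u i) (h2 i) g

theorem exists_abs_invDeriv_le (X : Fin d → GroupLieAlgebra (𝓡 d) G) {f : G → ℝ}
    (hf : f ∈ smoothCompSupp d G) :
    ∃ C, 0 ≤ C ∧ ∀ (u : Fin d → ℝ) (g : G),
      |invDeriv (∑ i, u i • X i) f g| ≤ C * (∑ i, |u i|) ^ 1 := by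
  simp only [invDeriv_sum_smul_vector]
  refine exists_abs_sum_mul_le (m := 0) (F := fun i _ g => invDeriv (X i) f g) fun i => ?_
  obtain ⟨C, h0, hC⟩ := exists_abs_le_of_mem_smoothCompSupp (invDeriv_mem_smoothCompSupp (X i) hf)
  exact ⟨C, h0, fun u g => by simpa using hC g⟩

theorem exists_abs_invDeriv_invDeriv_le (X : Fin d → GroupLieAlgebra (𝓡 d) G) {f : G → ℝ}
    (hf : f ∈ smoothCompSupp d G) :
    ∃ C, 0 ≤ C ∧ ∀ (u : Fin d → ℝ) (g : G),
      |invDeriv (∑ i, u i • X i) (invDeriv (∑ i, u i • X i) f) g| ≤ C * (∑ i, |u i|) ^ 2 := by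
  have e := fun u => invDeriv_invDeriv_sum_smul X u (∑ i, u i • X i) hf
  simp only [e]
  exact exists_abs_sum_mul_le (m := 1)
    (F := fun i u g => invDeriv (∑ i, u i • X i) (invDeriv (X i) f) g)
    fun i => exists_abs_invDeriv_le X (invDeriv_mem_smoothCompSupp (X i) hf)

theorem exists_abs_invDeriv_invDeriv_invDeriv_le (X : Fin d → GroupLieAlgebra (𝓡 d) G)
    {f : G → ℝ} (hf : f ∈ smoothCompSupp d G) :
    ∃ C, 0 ≤ C ∧ ∀ (u : Fin d → ℝ) (g : G),
      |invDeriv (∑ i, u i • X i) (invDeriv (∑ i, u i • X i) (invDeriv (∑ i, u i • X i) f)) g|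
        ≤ C * (∑ i, |u i|) ^ 3 := by
  have e : ∀ u : Fin d → ℝ,
      invDeriv (∑ i, u i • X i) (invDeriv (∑ i, u i • X i) (invDeriv (∑ i, u i • X i) f)) =
      fun g => ∑ j, u j *
        invDeriv (∑ i, u i • X i) (invDeriv (∑ i, u i • X i) (invDeriv (X j) f)) g := by
    intro u
    have h2 : ∀ i, ContMDiff (𝓡 d) 𝓘(ℝ, ℝ) ∞
        (invDeriv (∑ i, u i • X i) (invDeriv (X i) f)) :=
      fun i => contMDiff_invDeriv _ (contMDiff_invDeriv (X i) hf.1)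
    rw [invDeriv_invDeriv_sum_smul X u _ hf]
    funext g
    rw [invDeriv_sum (f := fun j g => u j * invDeriv (∑ i, u i • X i) (invDeriv (X j) f) g)
      Finset.univ _ (fun i => contMDiff_const.mul (I' := 𝓡 d) (h2 i))]
    exact Finset.sum_congr rfl fun i _ => invDeriv_const_mul _ (u i) (h2 i) g
  simp only [e]
  exact exists_abs_sum_mul_le (m := 2)
    (F := fun j u g => invDeriv (∑ i, u i • X i)
      (invDeriv (∑ i, u i • X i) (invDeriv (X j) f)) g)
    fun i => exists_abs_invDeriv_invDeriv_le X (invDeriv_mem_smoothCompSupp (X i) hf)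

variable [T2Space G]

/-- First-order Taylor expansion at the neutral element along one-parameter subgroups, with a
remainder that is uniform in the direction. -/
theorem exists_taylor_one_lieExp (X : Fin d → GroupLieAlgebra (𝓡 d) G) {f : G → ℝ}
    (hf : f ∈ smoothCompSupp d G) :
    ∃ C, 0 ≤ C ∧ ∀ u : Fin d → ℝ,
      |f (lieExp (∑ i, u i • X i)) - f 1 - ∑ i, u i * invDeriv (X i) f 1|
        ≤ C * (∑ i, |u i|) ^ 2 := by
  obtain ⟨C, h0, hC⟩ := exists_abs_invDeriv_invDeriv_le X hf
  refine ⟨C, h0, fun u => ?_⟩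
  obtain ⟨hγ0, hγ⟩ := (exists_lieCurve (∑ i, u i • X i)).choose_spec
  have := taylor_one_abs_le (hasDerivAt_comp_integralCurve hγ hf.1)
    (hasDerivAt_comp_integralCurve hγ (contMDiff_invDeriv _ hf.1)) (fun t => hC u _)
  rw [hγ0, invDeriv_sum_smul_vector] at this
  exact this

/-- Second-order Taylor expansion at the neutral element along one-parameter subgroups, with a
remainder that is uniform in the direction. -/
theorem exists_taylor_two_lieExp (X : Fin d → GroupLieAlgebra (𝓡 d) G) {f : G → ℝ}
    (hf : f ∈ smoothCompSupp d G) :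
    ∃ C, 0 ≤ C ∧ ∀ u : Fin d → ℝ,
      |f (lieExp (∑ i, u i • X i)) - f 1 - ∑ i, u i * invDeriv (X i) f 1
        - (∑ j, ∑ k, u j * u k * invDeriv (X j) (invDeriv (X k) f) 1) / 2|
        ≤ C * (∑ i, |u i|) ^ 3 := by
  obtain ⟨C, h0, hC⟩ := exists_abs_invDeriv_invDeriv_invDeriv_le X hf
  refine ⟨C, h0, fun u => ?_⟩
  obtain ⟨hγ0, hγ⟩ := (exists_lieCurve (∑ i, u i • X i)).choose_spec
  have := taylor_two_abs_le (hasDerivAt_comp_integralCurve hγ hf.1)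
    (hasDerivAt_comp_integralCurve hγ (contMDiff_invDeriv _ hf.1))
    (hasDerivAt_comp_integralCurve hγ (contMDiff_invDeriv _ (contMDiff_invDeriv _ hf.1)))
    (fun t => hC u _)
  rw [hγ0, invDeriv_invDeriv_sum_smul X u _ hf, invDeriv_sum_smul_vector] at this
  refine le_trans (le_of_eq ?_) this
  congr 3
  change _ = ∑ i, _
  -- The `X i` need not commute; only the names of the two summation indices are matched here, not
  -- the order of differentiation.
  rw [Finset.sum_comm]
  refine Finset.sum_congr rfl fun j _ => ?_
  rw [invDeriv_sum_smul_vector, Finset.mul_sum]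
  exact Finset.sum_congr rfl fun i _ => by ring

end Taylor

/-! ### Taylor expansion and vanishing of derivatives in canonical coordinates. -/

section CanonicalCoordinates

theorem sq_sum_abs_le {n : ℕ} (u : Fin n → ℝ) : (∑ i, |u i|) ^ 2 ≤ n * ∑ i, u i ^ 2 := by
  have := sq_sum_le_card_mul_sum_sq (s := Finset.univ) (f := fun i => |u i|)
  simpa using this

open Filter Topology

variable {d : ℕ} {G : Type*} [TopologicalSpace G] [ChartedSpace (EuclideanSpace ℝ (Fin d)) G]
  [Group G] [LieGroup (𝓡 d) ∞ G] [T2Space G]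
  {X : Module.Basis (Fin d) ℝ (GroupLieAlgebra (𝓡 d) G)} {U : Set G} {x : Fin d → G → ℝ}

/-- In coordinates of the first kind, the exponential map is continuous at the origin. -/
theorem tendsto_lieExp_one (X : Fin d → GroupLieAlgebra (𝓡 d) G) :
    Tendsto (fun u : Fin d → ℝ => lieExp (∑ i, u i • X i)) (𝓝 0) (𝓝 (1 : G)) := by
  intro O hO
  -- Membership in `O` is read off from a bump `φ` supported in `O`: the first-order expansion
  -- bounds `φ (exp u)` below by a continuous function of `u` equal to `1` at `0`, so `φ (exp u) >
  -- 0` for small `u`.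
  obtain ⟨φ, hφ, -, -, h1, hO'⟩ := exists_smooth_bump_nhds (d := d) hO
  obtain ⟨C, h0, hC⟩ := exists_taylor_one_lieExp X hφ
  have hlim : Tendsto (fun u : Fin d → ℝ =>
      φ 1 + ∑ i, u i * invDeriv (X i) φ 1 - C * (∑ i, |u i|) ^ 2) (𝓝 0) (𝓝 1) := by
    have : Continuous fun u : Fin d → ℝ =>
      φ 1 + ∑ i, u i * invDeriv (X i) φ 1 - C * (∑ i, |u i|) ^ 2 := by fun_prop
    simpa [h1.self_of_nhds] using this.tendsto 0
  refine mem_map.2 ?_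
  filter_upwards [hlim.eventually (lt_mem_nhds zero_lt_one)] with u hu
  apply hO'
  apply subset_tsupport
  have := (abs_le.1 (hC u)).1
  exact (by linarith : 0 < φ (lieExp (∑ i, u i • X i))).ne'

namespace IsCanonicalCoords

theorem exists_taylor_one (hx : IsCanonicalCoords X U x) {f : G → ℝ}
    (hf : f ∈ smoothCompSupp d G) :
    ∃ C, 0 ≤ C ∧ ∀ τ ∈ U,
      |f τ - f 1 - ∑ i, x i τ * invDeriv (X i) f 1| ≤ C * ∑ i, x i τ ^ 2 := by
  obtain ⟨C, h0, hC⟩ := exists_taylor_one_lieExp X hf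
  refine ⟨C * d, by positivity, fun τ hτ => ?_⟩
  have := hC (fun i => x i τ)
  rw [hx.exp_coords τ hτ] at this
  rw [mul_assoc]
  exact this.trans (mul_le_mul_of_nonneg_left (sq_sum_abs_le fun i => x i τ) h0)

/-- The cube `(∑ |xᵢ|)³` is split by Cauchy–Schwarz so that one factor `∑ |xᵢ|` remains apart: it
tends to `0` at `1`, which makes the remainder `o(∑ xᵢ²)`. -/
theorem exists_taylor_two (hx : IsCanonicalCoords X U x) {f : G → ℝ}
    (hf : f ∈ smoothCompSupp d G) :
    ∃ C, 0 ≤ C ∧ ∀ τ ∈ U,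
      |f τ - f 1 - ∑ i, x i τ * invDeriv (X i) f 1
        - (∑ j, ∑ k, x j τ * x k τ * invDeriv (X j) (invDeriv (X k) f) 1) / 2|
        ≤ C * (∑ i, |x i τ|) * ∑ i, x i τ ^ 2 := by
  obtain ⟨C, h0, hC⟩ := exists_taylor_two_lieExp X hf
  refine ⟨C * d, by positivity, fun τ hτ => ?_⟩
  have := hC (fun i => x i τ)
  rw [hx.exp_coords τ hτ] at this
  refine this.trans ?_
  have h1 : 0 ≤ ∑ i, |x i τ| := Finset.sum_nonneg fun _ _ => abs_nonneg _
  calc C * (∑ i, |x i τ|) ^ 3 = C * (∑ i, |x i τ|) * (∑ i, |x i τ|) ^ 2 := by ring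
    _ ≤ C * (∑ i, |x i τ|) * (d * ∑ i, x i τ ^ 2) :=
        mul_le_mul_of_nonneg_left (sq_sum_abs_le fun i => x i τ) (by positivity)
    _ = _ := by ring

theorem eq_one_of_coords_eq_zero (hx : IsCanonicalCoords X U x) {τ : G} (hτ : τ ∈ U)
    (h : ∀ i, x i τ = 0) : τ = 1 := by
  refine (hx.exp_coords τ hτ).symm.trans (Eq.trans ?_ (hx.exp_coords 1 hx.one_mem))
  simp only [h, hx.map_one]

/-- A function that is `O(|x|²)` at the neutral element has vanishing first derivatives there. -/
theorem invDeriv_eq_zero (hx : IsCanonicalCoords X U x) {f : G → ℝ}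
    (hf : f ∈ smoothCompSupp d G) {C : ℝ} (hC : ∀ᶠ τ in 𝓝 1, |f τ| ≤ C * ∑ i, x i τ ^ 2)
    (i : Fin d) : invDeriv (X i) f 1 = 0 := by
  obtain ⟨C', h0, hC'⟩ := exists_taylor_one_lieExp X hf
  have hf1 : f 1 = 0 := by
    have := hC.self_of_nhds
    simpa [hx.map_one] using this
  have hV : (fun (g : G) (i : Fin d) => x i g) '' U ∈ 𝓝 (0 : Fin d → ℝ) :=
    hx.isOpen_image.mem_nhds ⟨1, hx.one_mem, funext hx.map_one⟩
  have hs : Tendsto (fun t : ℝ => (Pi.single i t : Fin d → ℝ)) (𝓝 0) (𝓝 0) := by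
    have : Continuous fun t : ℝ => (Pi.single i t : Fin d → ℝ) :=
      continuous_single (A := fun _ : Fin d => ℝ) i
    simpa using this.tendsto 0
  -- At the point with coordinates `t eᵢ`, the hypothesis and the Taylor bound together give `|t Xᵢ
  -- f(1)| ≤ (C + C') t²`; divide by `t` and let `t → 0`.
  have key : ∀ᶠ t : ℝ in 𝓝[>] 0, |invDeriv (X i) f 1| ≤ (C + C') * t := by
    have e1 := hs.eventually hV
    have e2 := hs.eventually ((tendsto_lieExp_one X).eventually hC)
    filter_upwards [nhdsWithin_le_nhds e1, nhdsWithin_le_nhds e2, self_mem_nhdsWithin]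
      with t h1 h2 ht
    obtain ⟨g, hg, hgt⟩ := h1
    have hgt' : ∀ j, x j g = (Pi.single i t : Fin d → ℝ) j := fun j => congrFun hgt j
    have hexp : lieExp (∑ j, (Pi.single i t : Fin d → ℝ) j • X j) = g := by
      rw [← hx.exp_coords g hg]; simp only [hgt']
    have h3 := hC' (Pi.single i t)
    rw [hexp] at h2 h3
    have s1 : ∑ j, (Pi.single i t : Fin d → ℝ) j * invDeriv (X j) f 1 =
        t * invDeriv (X i) f 1 := by
      rw [Finset.sum_eq_single i (fun j _ hj => by simp [hj]) (by simp)]; simp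
    have s2 : ∑ j, |(Pi.single i t : Fin d → ℝ) j| = t := by
      rw [Finset.sum_eq_single i (fun j _ hj => by simp [hj]) (by simp)]
      simpa using le_of_lt ht
    have s3 : ∑ j, x j g ^ 2 = t ^ 2 := by
      rw [Finset.sum_eq_single i (fun j _ hj => by simp [hgt', hj]) (by simp)]; simp [hgt']
    rw [s1, s2, hf1, sub_zero] at h3
    rw [s3] at h2
    have h4 : |t * invDeriv (X i) f 1| ≤ (C + C') * t ^ 2 := by
      rw [abs_le] at *
      constructor <;> linarith
    rw [abs_mul, abs_of_pos ht] at h4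
    refine le_of_mul_le_mul_left (a := t) ?_ ht
    linarith
  have hlim : Tendsto (fun t : ℝ => (C + C') * t) (𝓝[>] 0) (𝓝 0) := by
    have : Continuous fun t : ℝ => (C + C') * t := by fun_prop
    simpa using (this.tendsto 0).mono_left nhdsWithin_le_nhds
  exact abs_nonpos_iff.1 (ge_of_tendsto hlim key)

end IsCanonicalCoords

/-! ### First and second derivative tests at the neutral element. -/

theorem invDeriv_eq_zero_of_forall_le (v : GroupLieAlgebra (𝓡 d) G) {f : G → ℝ}
    (hf : ContMDiff (𝓡 d) 𝓘(ℝ, ℝ) ∞ f) (h : ∀ τ, f τ ≤ f 1) : invDeriv v f 1 = 0 := by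
  obtain ⟨γ, hγ0, hγ⟩ := exists_lieCurve v
  have h1 := hasDerivAt_comp_integralCurve hγ hf 0
  have hmax : IsLocalMax (fun t => f (γ t)) 0 := .of_forall fun t => by simpa [hγ0] using h (γ t)
  rw [hγ0] at h1
  exact hmax.hasDerivAt_eq_zero h1

theorem invDeriv_eq_zero_of_forall_ge (v : GroupLieAlgebra (𝓡 d) G) {f : G → ℝ}
    (hf : ContMDiff (𝓡 d) 𝓘(ℝ, ℝ) ∞ f) (h : ∀ τ, f 1 ≤ f τ) : invDeriv v f 1 = 0 := by
  obtain ⟨γ, hγ0, hγ⟩ := exists_lieCurve v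
  have h1 := hasDerivAt_comp_integralCurve hγ hf 0
  have hmin : IsLocalMin (fun t => f (γ t)) 0 := .of_forall fun t => by simpa [hγ0] using h (γ t)
  rw [hγ0] at h1
  exact hmin.hasDerivAt_eq_zero h1

theorem invDeriv_invDeriv_nonpos_of_forall_le (v : GroupLieAlgebra (𝓡 d) G) {f : G → ℝ}
    (hf : ContMDiff (𝓡 d) 𝓘(ℝ, ℝ) ∞ f) (h : ∀ τ, f τ ≤ f 1) :
    invDeriv v (invDeriv v f) 1 ≤ 0 := by
  obtain ⟨γ, hγ0, hγ⟩ := exists_lieCurve v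
  have h1 : deriv (fun t => f (γ t)) = fun t => invDeriv v f (γ t) :=
    funext fun t => (hasDerivAt_comp_integralCurve hγ hf t).deriv
  have h2 : deriv (deriv fun t => f (γ t)) 0 = invDeriv v (invDeriv v f) 1 := by
    rw [h1, (hasDerivAt_comp_integralCurve hγ (contMDiff_invDeriv v hf) 0).deriv, hγ0]
  -- A positive second derivative would make `0` a local minimum as well as a maximum of `f ∘ γ`;
  -- then `f ∘ γ` is constant near `0` and its second derivative is `0`.
  by_contra! hpos
  rw [← h2] at hpos
  have hmin : IsLocalMin (fun t => f (γ t)) 0 :=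
    isLocalMin_of_deriv_deriv_pos hpos (by
      simp only [h1, hγ0]; exact invDeriv_eq_zero_of_forall_le v hf h)
      (hasDerivAt_comp_integralCurve hγ hf 0).continuousAt
  have hconst : (fun t => f (γ t)) =ᶠ[𝓝 0] fun _ => f 1 := by
    filter_upwards [hmin] with t ht
    exact le_antisymm (h (γ t)) (by simpa [hγ0] using ht)
  have h3 : deriv (fun t => f (γ t)) =ᶠ[𝓝 0] fun _ => 0 := by
    simpa using hconst.deriv
  rw [h3.deriv_eq, deriv_const] at hpos
  exact lt_irrefl _ hpos

end CanonicalCoordinates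

/-! ### From positive functionals on test functions to measures. -/

section RepresentingMeasure

open Filter Topology CompactlySupported

variable {d : ℕ} {G : Type*} [TopologicalSpace G] [ChartedSpace (EuclideanSpace ℝ (Fin d)) G]

/-- The inclusion of `C_c^∞(G)` into `C_c(G)`. -/
def smoothCompSuppToCompactlySupported : smoothCompSupp d G →ₗ[ℝ] C_c(G, ℝ) where
  toFun f := ⟨⟨f, f.2.1.continuous⟩, f.2.2⟩
  map_add' _ _ := rfl
  map_smul' _ _ := rfl

theorem smoothCompSuppToCompactlySupported_injective :
    Function.Injective (smoothCompSuppToCompactlySupported (d := d) (G := G)) :=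
  fun _ _ h => Subtype.ext (funext fun τ => DFunLike.congr_fun h τ)

variable [T2Space G] [IsManifold (𝓡 d) ∞ G]

/-- A positive linear functional on `C_c^∞(G)` extends to a positive linear functional on
`C_c(G)`. -/
theorem exists_positive_extension (L : smoothCompSupp d G →ₗ[ℝ] ℝ)
    (hL : ∀ f : smoothCompSupp d G, (∀ τ, 0 ≤ (f : G → ℝ) τ) → 0 ≤ L f) :
    ∃ Λ : C_c(G, ℝ) →ₚ[ℝ] ℝ, ∀ f, Λ (smoothCompSuppToCompactlySupported f) = L f := by
  let ι := smoothCompSuppToCompactlySupported (d := d) (G := G)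
  let e := LinearEquiv.ofInjective ι smoothCompSuppToCompactlySupported_injective
  let P : C_c(G, ℝ) →ₗ.[ℝ] ℝ := ⟨LinearMap.range ι, L ∘ₗ e.symm.toLinearMap⟩
  let K : PointedCone ℝ C_c(G, ℝ) :=
    { carrier := {f | ∀ τ, 0 ≤ f τ}
      add_mem' := fun hf hg τ => add_nonneg (hf τ) (hg τ)
      zero_mem' := fun τ => le_rfl
      smul_mem' := fun r f hf τ => mul_nonneg r.2 (hf τ) }
  have nonneg : ∀ f : P.domain, (f : C_c(G, ℝ)) ∈ K → 0 ≤ P f := by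
    rintro ⟨_, f, rfl⟩ hf
    have h2 : P ⟨ι f, f, rfl⟩ = L f := congrArg L (e.symm_apply_apply f)
    rw [h2]
    exact hL f hf
  -- The domination condition of the M. Riesz extension theorem: a smooth bump equal to `1` on the
  -- support of `y`, scaled by a bound for `|y|`, dominates `-y`.
  have dense : ∀ y, ∃ f : P.domain, (f : C_c(G, ℝ)) + y ∈ K := by
    intro y
    obtain ⟨ψ, hψ, h0, h1, hK⟩ := exists_smooth_bump_isCompact (d := d) y.hasCompactSupport
    obtain ⟨C, hC⟩ := y.hasCompactSupport.exists_bound_of_continuous y.continuous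
    refine ⟨⟨ι (|C| • ⟨ψ, hψ⟩), _, rfl⟩, fun τ => ?_⟩
    change 0 ≤ |C| * ψ τ + y τ
    by_cases hτ : τ ∈ tsupport y
    · rw [hK τ hτ, mul_one]
      have := (hC τ).trans (le_abs_self C)
      linarith [(abs_le.1 this).1]
    · rw [image_eq_zero_of_notMem_tsupport hτ, add_zero]
      exact mul_nonneg (abs_nonneg _) (h0 τ)
  obtain ⟨g, hg, hg0⟩ := riesz_extension K P nonneg dense
  refine ⟨PositiveLinearMap.mk₀ g fun f hf => hg0 f fun τ => hf τ, fun f => ?_⟩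
  have h1 := hg (e f)
  have h2 : P (e f) = L f := congrArg L (e.symm_apply_apply f)
  exact h1.trans h2

/-- A positive linear functional on `C_c^∞(G)` that is bounded for the uniform norm is given by
a finite regular measure. -/
theorem exists_regular_measure_of_bounded [MeasurableSpace G] [BorelSpace G]
    (L : smoothCompSupp d G →ₗ[ℝ] ℝ)
    (hL : ∀ f : smoothCompSupp d G, (∀ τ, 0 ≤ (f : G → ℝ) τ) → 0 ≤ L f) (M : ℝ)
    (hM : ∀ f : smoothCompSupp d G, (∀ τ, 0 ≤ (f : G → ℝ) τ) → (∀ τ, (f : G → ℝ) τ ≤ 1) →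
      L f ≤ M) :
    ∃ m : Measure G, IsFiniteMeasure m ∧ m.Regular ∧
      ∀ f : smoothCompSupp d G, L f = ∫ τ, (f : G → ℝ) τ ∂m := by
  have : LocallyCompactSpace G := ChartedSpace.locallyCompactSpace (EuclideanSpace ℝ (Fin d)) G
  obtain ⟨Λ, hΛ⟩ := exists_positive_extension L hL
  refine ⟨RealRMK.rieszMeasure Λ, ⟨?_⟩, inferInstance, fun f => ?_⟩
  · refine lt_of_le_of_lt ?_ (ENNReal.ofReal_lt_top (r := M))
    -- By inner regularity the total mass is the supremum over compact sets, each of mass at most `L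
    -- ψ ≤ M` for a bump `ψ` equal to `1` on it.
    rw [isOpen_univ.measure_eq_iSup_isCompact]
    refine iSup₂_le fun K _ => iSup_le fun hK => ?_
    obtain ⟨ψ, hψ, h0, h1, hψK⟩ := exists_smooth_bump_isCompact (d := d) hK
    refine (RealRMK.rieszMeasure_le_of_eq_one Λ
      (f := smoothCompSuppToCompactlySupported ⟨ψ, hψ⟩) h0 hK hψK).trans ?_
    rw [hΛ]
    exact ENNReal.ofReal_le_ofReal (hM _ h0 h1)
  · rw [← hΛ, ← RealRMK.integral_rieszMeasure]
    rfl

end RepresentingMeasure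

/-! ### The weight `∑ xᵢ² + (1 - φ)` and Lévy measures. -/

section CoordinateWeight

open Filter Topology

/-- A smooth cut-off function at the neutral element, supported in `U`. -/
structure IsCutoff (d : ℕ) {G : Type*} [TopologicalSpace G]
    [ChartedSpace (EuclideanSpace ℝ (Fin d)) G] [One G] (φ : G → ℝ) (U : Set G) : Prop where
  mem : φ ∈ smoothCompSupp d G
  nonneg : ∀ τ, 0 ≤ φ τ
  le_one : ∀ τ, φ τ ≤ 1
  eventually_eq_one : ∀ᶠ τ in 𝓝 1, φ τ = 1
  tsupport_subset : tsupport φ ⊆ U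

/-- A function comparable to `|x|²` near the neutral element, and to `1` away from it. -/
def coordWeight {d : ℕ} {G : Type*} (x : Fin d → G → ℝ) (φ : G → ℝ) (τ : G) : ℝ :=
  ∑ i, x i τ ^ 2 + (1 - φ τ)

theorem one_sub_le_coordWeight {d : ℕ} {G : Type*} (x : Fin d → G → ℝ) (φ : G → ℝ) (τ : G) :
    1 - φ τ ≤ coordWeight x φ τ := by
  unfold coordWeight
  linarith [Finset.sum_nonneg fun i (_ : i ∈ Finset.univ) => sq_nonneg (x i τ)]

variable {d : ℕ} {G : Type*} [TopologicalSpace G] [ChartedSpace (EuclideanSpace ℝ (Fin d)) G]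

/-- Multiplication by a smooth function, as a linear endomorphism of `C_c^∞(G)`. -/
def smoothCompSuppMul (h : G → ℝ) (hh : ContMDiff (𝓡 d) 𝓘(ℝ, ℝ) ∞ h) :
    smoothCompSupp d G →ₗ[ℝ] smoothCompSupp d G where
  toFun f := ⟨fun τ => (f : G → ℝ) τ * h τ, mul_mem_smoothCompSupp f.2 hh⟩
  map_add' _ _ := Subtype.ext (funext fun _ => add_mul _ _ _)
  map_smul' _ _ := Subtype.ext (funext fun _ => mul_assoc _ _ _)

variable [Group G]

theorem exists_isCutoff [T2Space G] [IsManifold (𝓡 d) ∞ G] {U : Set G} (hU : U ∈ 𝓝 1) :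
    ∃ φ : G → ℝ, IsCutoff d φ U := by
  obtain ⟨φ, h1, h2, h3, h4, h5⟩ := exists_smooth_bump_nhds (d := d) hU
  exact ⟨φ, h1, h2, h3, h4, h5⟩

theorem sq_sum_le_coordWeight {x : Fin d → G → ℝ} {φ : G → ℝ} {U : Set G}
    (hφ : IsCutoff d φ U) (τ : G) : ∑ i, x i τ ^ 2 ≤ coordWeight x φ τ := by
  unfold coordWeight; linarith [hφ.le_one τ]

theorem coordWeight_nonneg {x : Fin d → G → ℝ} {φ : G → ℝ} {U : Set G}
    (hφ : IsCutoff d φ U) (τ : G) : 0 ≤ coordWeight x φ τ :=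
  le_trans (by linarith [hφ.le_one τ]) (one_sub_le_coordWeight x φ τ)

variable [LieGroup (𝓡 d) ∞ G] [T2Space G]
  {X : Module.Basis (Fin d) ℝ (GroupLieAlgebra (𝓡 d) G)} {U : Set G} {x : Fin d → G → ℝ}
  {φ : G → ℝ}

namespace IsCanonicalCoords

theorem sq_sum_mem_smoothCompSupp (hx : IsCanonicalCoords X U x) :
    (fun τ => ∑ i, x i τ ^ 2) ∈ smoothCompSupp d G := by
  refine sum_mem_smoothCompSupp Finset.univ fun i => ?_
  simp only [pow_two]
  exact mul_mem_smoothCompSupp' (hx.mem_smoothCompSupp i) (hx.mem_smoothCompSupp i)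

theorem contMDiff_coordWeight (hx : IsCanonicalCoords X U x) (hφ : IsCutoff d φ U) :
    ContMDiff (𝓡 d) 𝓘(ℝ, ℝ) ∞ (coordWeight x φ) :=
  hx.sq_sum_mem_smoothCompSupp.1.add (contMDiff_const.sub hφ.mem.1)

theorem coordWeight_one (hx : IsCanonicalCoords X U x) (hφ : IsCutoff d φ U) :
    coordWeight x φ 1 = 0 := by
  simp [coordWeight, hx.map_one, hφ.eventually_eq_one.self_of_nhds]

theorem coordWeight_pos (hx : IsCanonicalCoords X U x) (hφ : IsCutoff d φ U) {τ : G}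
    (hτ : τ ≠ 1) : 0 < coordWeight x φ τ := by
  by_cases hU : τ ∈ U
  · refine lt_of_lt_of_le ?_ (sq_sum_le_coordWeight hφ τ)
    refine (Finset.sum_nonneg fun i _ => sq_nonneg _).lt_of_ne fun h => hτ ?_
    rw [eq_comm, Finset.sum_eq_zero_iff_of_nonneg fun i _ => sq_nonneg _] at h
    exact hx.eq_one_of_coords_eq_zero hU fun i => by simpa using h i (Finset.mem_univ i)
  · refine lt_of_lt_of_le ?_ (one_sub_le_coordWeight x φ τ)
    rw [image_eq_zero_of_notMem_tsupport fun h => hU (hφ.tsupport_subset h)]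
    norm_num

/-- A non-negative function vanishing at `1` has a minimum there, so its first derivatives vanish
and it is `O(∑ xᵢ²)` on `U`. Off `U` the cut-off is `0`, so the weight is at least `1` and
boundedness suffices. -/
theorem exists_le_mul_coordWeight (hx : IsCanonicalCoords X U x) (hφ : IsCutoff d φ U)
    {f : G → ℝ} (hf : f ∈ smoothCompSupp d G) (h0 : ∀ τ, 0 ≤ f τ) (h1 : f 1 = 0) :
    ∃ C, 0 ≤ C ∧ ∀ τ, f τ ≤ C * coordWeight x φ τ := by
  obtain ⟨C, hC0, hC⟩ := hx.exists_taylor_one hf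
  obtain ⟨C', hC0', hC'⟩ := exists_abs_le_of_mem_smoothCompSupp hf
  refine ⟨C + C', by positivity, fun τ => ?_⟩
  have hq := coordWeight_nonneg (x := x) hφ τ
  by_cases hU : τ ∈ U
  · have h2 := (abs_le.1 (hC τ hU)).2
    simp only [fun v => invDeriv_eq_zero_of_forall_ge v hf.1 (fun τ => h1 ▸ h0 τ), h1, mul_zero,
      Finset.sum_const_zero, sub_zero] at h2
    have h3 := mul_le_mul_of_nonneg_left (sq_sum_le_coordWeight (x := x) hφ τ) hC0
    have h4 := mul_nonneg hC0' hq
    linarith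
  · have h2 := one_sub_le_coordWeight x φ τ
    rw [image_eq_zero_of_notMem_tsupport fun h => hU (hφ.tsupport_subset h)] at h2
    have h3 := (abs_le.1 (hC' τ)).2
    have h4 := mul_nonneg hC0 hq
    have h5 := mul_le_mul_of_nonneg_left h2 hC0'
    linarith

/-- The weight vanishes only at `1`, and near `1` the quotient is identically `0`, with `0 / 0 = 0`
at the point itself. -/
theorem div_coordWeight_mem (hx : IsCanonicalCoords X U x) (hφ : IsCutoff d φ U)
    {h : G → ℝ} (hh : h ∈ smoothCompSupp d G) (h0 : ∀ᶠ τ in 𝓝 1, h τ = 0) :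
    (fun τ => h τ / coordWeight x φ τ) ∈ smoothCompSupp d G := by
  refine ⟨fun τ => ?_, ?_⟩
  · by_cases hτ : τ = 1
    · subst hτ
      refine (contMDiffAt_const (c := (0 : ℝ))).congr_of_eventuallyEq ?_
      filter_upwards [h0] with τ hτ
      simp [hτ]
    · exact (hh.1 τ).div₀ (hx.contMDiff_coordWeight hφ τ) (hx.coordWeight_pos hφ hτ).ne'
  · simp only [div_eq_mul_inv]
    exact hh.2.mul_right

theorem div_mul_coordWeight (hx : IsCanonicalCoords X U x) (hφ : IsCutoff d φ U)
    {h : G → ℝ} (h0 : h 1 = 0) (τ : G) : h τ / coordWeight x φ τ * coordWeight x φ τ = h τ := by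
  by_cases hτ : τ = 1
  · subst hτ; simp [h0]
  · exact div_mul_cancel₀ _ (hx.coordWeight_pos hφ hτ).ne'

variable [MeasurableSpace G]

/-- A measure integrating the weight is a Lévy measure. -/
theorem isLevyMeasure_of_integrable (hx : IsCanonicalCoords X U x) (hφ : IsCutoff d φ U)
    {ν : Measure G} (h1 : ν {1} = 0) (hν : Integrable (coordWeight x φ) ν) :
    IsLevyMeasure X ν := by
  refine ⟨h1, fun U' x' hx' => ?_, fun U' x' hx' => ?_⟩
  · obtain ⟨C, -, hC⟩ := hx.exists_le_mul_coordWeight hφ hx'.sq_sum_mem_smoothCompSupp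
      (fun τ => Finset.sum_nonneg fun i _ => sq_nonneg _) (by simp [hx'.map_one])
    calc ∫⁻ g in U', ENNReal.ofReal (∑ i, x' i g ^ 2) ∂ν
        ≤ ∫⁻ g, ENNReal.ofReal (∑ i, x' i g ^ 2) ∂ν := setLIntegral_le_lintegral _ _
      _ ≤ ∫⁻ g, ENNReal.ofReal (C * coordWeight x φ g) ∂ν :=
          lintegral_mono fun g => ENNReal.ofReal_le_ofReal (hC g)
      _ < ⊤ := (hν.const_mul C).lintegral_lt_top
  · obtain ⟨ψ, hψ⟩ := exists_isCutoff (d := d) (hx'.isOpen.mem_nhds hx'.one_mem)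
    obtain ⟨C, -, hC⟩ := hx.exists_le_mul_coordWeight hφ
      (mul_mem_smoothCompSupp hφ.mem ((contMDiff_const (c := (1 : ℝ))).sub hψ.mem.1))
      (fun τ => mul_nonneg (hφ.nonneg τ) (sub_nonneg.2 (hψ.le_one τ)))
      (by simp [hψ.eventually_eq_one.self_of_nhds])
    -- Off `U'` the cut-off `ψ` is `0`, so `φ = φ (1 - ψ) ≤ C q`; adding `1 - φ ≤ q` gives `1 ≤ (C +
    -- 1) q` there, and Markov's inequality applies.
    refine lt_of_le_of_lt (measure_mono fun τ hτ => ?_)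
      ((hν.const_mul (C + 1)).measure_ge_lt_top zero_lt_one)
    have h2 := hC τ
    have h3 : ψ τ = 0 := image_eq_zero_of_notMem_tsupport fun h => hτ (hψ.tsupport_subset h)
    simp only [h3, sub_zero, mul_one] at h2
    have h4 := one_sub_le_coordWeight x φ τ
    change 1 ≤ (C + 1) * coordWeight x φ τ
    linarith

variable [BorelSpace G]

/-- On `U` the remainder is `O(∑ xᵢ²)`, which `ν` integrates; off `U` it is bounded and `ν` is
finite. -/
theorem integrable_taylor_remainder (hx : IsCanonicalCoords X U x) {ν : Measure G}
    (hν : IsLevyMeasure X ν) {f : G → ℝ} (hf : f ∈ smoothCompSupp d G) :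
    Integrable (fun τ => f τ - f 1 - ∑ i, x i τ * invDeriv (X i) f 1) ν := by
  have hcont : Continuous fun τ => f τ - f 1 - ∑ i, x i τ * invDeriv (X i) f 1 :=
    (hf.1.continuous.sub continuous_const).sub (continuous_finsetSum _ fun i _ =>
      (hx.mem_smoothCompSupp i).1.continuous.mul continuous_const)
  have hmeas := hx.isOpen.measurableSet
  obtain ⟨C, -, hC⟩ := hx.exists_taylor_one hf
  have h1 : IntegrableOn (fun τ => f τ - f 1 - ∑ i, x i τ * invDeriv (X i) f 1) U ν := by
    have hsq : IntegrableOn (fun τ => ∑ i, x i τ ^ 2) U ν := by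
      refine ⟨hx.sq_sum_mem_smoothCompSupp.1.continuous.measurable.aestronglyMeasurable, ?_⟩
      rw [hasFiniteIntegral_iff_ofReal
        (.of_forall fun τ => Finset.sum_nonneg fun i _ => sq_nonneg _)]
      exact hν.lintegral_lt_top U x hx
    refine (hsq.const_mul C).mono' hcont.measurable.aestronglyMeasurable ?_
    exact (ae_restrict_iff' hmeas).2 (.of_forall hC)
  have h2 : IntegrableOn (fun τ => f τ - f 1 - ∑ i, x i τ * invDeriv (X i) f 1) Uᶜ ν := by
    obtain ⟨M, -, hM⟩ := exists_abs_le_of_mem_smoothCompSupp hf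
    obtain ⟨M', -, hM'⟩ := exists_abs_le_of_mem_smoothCompSupp (sum_mem_smoothCompSupp (d := d)
      Finset.univ (f := fun i τ => x i τ * invDeriv (X i) f 1)
      fun i => mul_mem_smoothCompSupp (hx.mem_smoothCompSupp i) contMDiff_const)
    refine Measure.integrableOn_of_bounded (M := M + |f 1| + M') (hν.compl_lt_top U x hx).ne
      hcont.measurable.aestronglyMeasurable (.of_forall fun τ => ?_)
    rw [Real.norm_eq_abs]
    exact (abs_sub _ _).trans (add_le_add ((abs_sub _ _).trans (add_le_add_left (hM τ) _)) (hM' τ))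
  simpa using h1.union h2

end IsCanonicalCoords

end CoordinateWeight

/-! ### The maximum principle at the neutral element and the construction of the Lévy measure. -/

section PositiveMaximumPrincipleAtOne

open Filter Topology

theorem exists_isCompact_measure_compl_le {G : Type*} [TopologicalSpace G] [T2Space G]
    [MeasurableSpace G] [BorelSpace G] (m : Measure G) [IsFiniteMeasure m] [m.Regular] {ε : ℝ}
    (hε : 0 < ε) : ∃ K, IsCompact K ∧ m.real Kᶜ ≤ ε := by
  obtain ⟨K, -, hK, h⟩ := MeasurableSet.univ.exists_isCompact_lt_add (μ := m)
    (measure_ne_top _ _) (ε := ENNReal.ofReal ε) (by simpa using hε)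
  refine ⟨K, hK, ?_⟩
  refine ENNReal.toReal_le_of_le_ofReal hε.le ?_
  rw [measure_compl hK.measurableSet (measure_ne_top _ _)]
  exact tsub_le_iff_left.2 h.le

variable {d : ℕ} {G : Type*} [TopologicalSpace G] [ChartedSpace (EuclideanSpace ℝ (Fin d)) G]
  [Group G]

/-- The positive maximum principle at the neutral element, for a linear functional. -/
def PositiveMaximumAtOne (T : smoothCompSupp d G →ₗ[ℝ] ℝ) : Prop :=
  ∀ f : smoothCompSupp d G, (∀ τ, (f : G → ℝ) τ ≤ (f : G → ℝ) 1) → 0 ≤ (f : G → ℝ) 1 → T f ≤ 0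

namespace PositiveMaximumAtOne

variable {T : smoothCompSupp d G →ₗ[ℝ] ℝ}

theorem map_nonneg (hT : PositiveMaximumAtOne T) {f : smoothCompSupp d G}
    (h0 : ∀ τ, 0 ≤ (f : G → ℝ) τ) (h1 : (f : G → ℝ) 1 = 0) : 0 ≤ T f := by
  have := hT (-f) (fun τ => by simpa [h1] using h0 τ) (by simp [h1])
  rw [map_neg] at this
  linarith

/-- The function `φ + ψ (1 - φ)` is at most `1` everywhere and equals `1` at the neutral element, so
the maximum principle applies to it. -/
theorem map_cutoff_le (hT : PositiveMaximumAtOne T) {U : Set G} {φ : G → ℝ}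
    (hφ : IsCutoff d φ U)
    (ψ : smoothCompSupp d G) (h1 : ∀ τ, (ψ : G → ℝ) τ ≤ 1) :
    T (smoothCompSuppMul (fun τ => 1 - φ τ) (contMDiff_const.sub hφ.mem.1) ψ)
      ≤ -T ⟨φ, hφ.mem⟩ := by
  have hφ1 := hφ.eventually_eq_one.self_of_nhds
  have := hT (⟨φ, hφ.mem⟩ +
    smoothCompSuppMul (fun τ => 1 - φ τ) (contMDiff_const.sub hφ.mem.1) ψ) (fun τ => ?_) ?_
  · rw [map_add] at this; linarith
  · change φ τ + (ψ : G → ℝ) τ * (1 - φ τ) ≤ φ 1 + (ψ : G → ℝ) 1 * (1 - φ 1)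
    rw [hφ1]
    nlinarith [hφ.le_one τ, h1 τ]
  · change 0 ≤ φ 1 + (ψ : G → ℝ) 1 * (1 - φ 1)
    rw [hφ1]; norm_num

variable [LieGroup (𝓡 d) ∞ G] [T2Space G]
  {X : Module.Basis (Fin d) ℝ (GroupLieAlgebra (𝓡 d) G)} {U : Set G} {x : Fin d → G → ℝ}
  {φ : G → ℝ}

/-- The functional `f ↦ T (f q)` is bounded on functions with values in `[0, 1]`. -/
theorem map_mul_coordWeight_le (hT : PositiveMaximumAtOne T) (hx : IsCanonicalCoords X U x)
    (hφ : IsCutoff d φ U) (f : smoothCompSupp d G)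
    (h1 : ∀ τ, (f : G → ℝ) τ ≤ 1) :
    T (smoothCompSuppMul (coordWeight x φ) (hx.contMDiff_coordWeight hφ) f)
      ≤ T ⟨_, hx.sq_sum_mem_smoothCompSupp⟩ - T ⟨φ, hφ.mem⟩ := by
  let Q : smoothCompSupp d G := ⟨_, hx.sq_sum_mem_smoothCompSupp⟩
  -- The two terms of the weight are bounded separately: `(∑ xᵢ²)(1 - f)` is non-negative and
  -- vanishes at `1`, and `(1 - φ) f` is covered by `map_cutoff_le`.
  have hA := hT.map_nonneg
    (f := Q - smoothCompSuppMul _ hx.sq_sum_mem_smoothCompSupp.1 f) (fun τ => ?_) ?_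
  · have hB := hT.map_cutoff_le hφ f h1
    have hE : smoothCompSuppMul (coordWeight x φ) (hx.contMDiff_coordWeight hφ) f =
        smoothCompSuppMul _ hx.sq_sum_mem_smoothCompSupp.1 f +
        smoothCompSuppMul (fun τ => 1 - φ τ) (contMDiff_const.sub hφ.mem.1) f :=
      Subtype.ext (funext fun τ => mul_add _ _ _)
    rw [hE, map_add]
    rw [map_sub] at hA
    linarith
  · change 0 ≤ ∑ i, x i τ ^ 2 - (f : G → ℝ) τ * ∑ i, x i τ ^ 2
    nlinarith [h1 τ, Finset.sum_nonneg fun i (_ : i ∈ Finset.univ) => sq_nonneg (x i τ)]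
  · change ∑ i, x i 1 ^ 2 - (f : G → ℝ) 1 * ∑ i, x i 1 ^ 2 = 0
    simp [hx.map_one]

variable [MeasurableSpace G] [BorelSpace G]

/-- The Lévy measure of a functional satisfying the positive maximum principle. -/
theorem exists_measure (hT : PositiveMaximumAtOne T) (hx : IsCanonicalCoords X U x)
    (hφ : IsCutoff d φ U) :
    ∃ ν : Measure G, ν {1} = 0 ∧ Integrable (coordWeight x φ) ν ∧
      (∀ h : smoothCompSupp d G, (∀ᶠ τ in 𝓝 1, (h : G → ℝ) τ = 0) →
        T h = ∫ τ, (h : G → ℝ) τ ∂ν) ∧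
      ∫ τ, (1 - φ τ) ∂ν ≤ -T ⟨φ, hφ.mem⟩ := by
  set q := coordWeight x φ with hq
  have hqs := hx.contMDiff_coordWeight hφ
  have hq0 : ∀ τ, 0 ≤ q τ := coordWeight_nonneg hφ
  have hq1 : q 1 = 0 := hx.coordWeight_one hφ
  have hqpos : ∀ τ, τ ≠ 1 → 0 < q τ := fun τ => hx.coordWeight_pos hφ
  obtain ⟨m, hm, hreg, hmL⟩ := exists_regular_measure_of_bounded (T ∘ₗ smoothCompSuppMul q hqs)
    (fun f hf => hT.map_nonneg (fun τ => mul_nonneg (hf τ) (hq0 τ))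
      (by change (f : G → ℝ) 1 * q 1 = 0; rw [hq1, mul_zero])) _
    (fun f _ h1 => hT.map_mul_coordWeight_le hx hφ f h1)
  have hmT : ∀ h : smoothCompSupp d G, (∀ᶠ τ in 𝓝 1, (h : G → ℝ) τ = 0) →
      T h = ∫ τ, (h : G → ℝ) τ / q τ ∂m := by
    intro h hh
    rw [← hmL ⟨_, hx.div_coordWeight_mem hφ h.2 hh⟩]
    refine congrArg T (Subtype.ext (funext fun τ => ?_))
    exact (hx.div_mul_coordWeight hφ hh.self_of_nhds τ).symm
  have hqm : Measurable fun τ => ENNReal.ofReal (q τ)⁻¹ :=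
    hqs.continuous.measurable.inv.ennreal_ofReal
  have hint : ∀ g : G → ℝ,
      ∫ τ, g τ ∂(m.restrict {1}ᶜ).withDensity (fun τ => ENNReal.ofReal (q τ)⁻¹) =
        ∫ τ, g τ / q τ ∂m := by
    intro g
    rw [integral_withDensity_eq_integral_toReal_smul hqm (.of_forall fun τ => by simp)]
    have e : ∀ τ, (ENNReal.ofReal (q τ)⁻¹).toReal • g τ = g τ / q τ := fun τ => by
      rw [ENNReal.toReal_ofReal (inv_nonneg.2 (hq0 τ)), smul_eq_mul, div_eq_inv_mul]
    simp only [e]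
    refine setIntegral_eq_integral_of_forall_compl_eq_zero fun τ hτ => ?_
    have : τ = 1 := by simpa using hτ
    rw [this, hq1, div_zero]
  -- An atom of `m` at `1` is discarded: it does not act on functions vanishing near `1`, and its
  -- effect on `T` will be absorbed by the second-order coefficients.
  refine ⟨(m.restrict {1}ᶜ).withDensity fun τ => ENNReal.ofReal (q τ)⁻¹, ?_, ?_, ?_, ?_⟩
  · exact withDensity_absolutelyContinuous _ _ (by simp)
  · rw [integrable_withDensity_iff hqm (.of_forall fun τ => by simp)]
    refine (integrable_const (1 : ℝ)).mono'
      (hqs.continuous.measurable.mul hqm.ennreal_toReal).aestronglyMeasurable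
      (.of_forall fun τ => ?_)
    rw [ENNReal.toReal_ofReal (inv_nonneg.2 (hq0 τ)), Real.norm_eq_abs,
      abs_of_nonneg (mul_nonneg (hq0 τ) (inv_nonneg.2 (hq0 τ)))]
    exact mul_inv_le_one
  · intro h hh
    rw [hint, hmT h hh]
  · rw [hint]
    have hk0 : ∀ τ, 0 ≤ (1 - φ τ) / q τ := fun τ =>
      div_nonneg (sub_nonneg.2 (hφ.le_one τ)) (hq0 τ)
    have hk1 : ∀ τ, (1 - φ τ) / q τ ≤ 1 := fun τ =>
      div_le_one_of_le₀ (one_sub_le_coordWeight x φ τ) (hq0 τ)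
    have hkm : Measurable fun τ => (1 - φ τ) / q τ :=
      (measurable_const.sub hφ.mem.1.continuous.measurable).div hqs.continuous.measurable
    -- `1 - φ` need not have compact support, so `T` is not defined on it. It is replaced by `ψ (1 -
    -- φ)` with `ψ = 1` on a compact set carrying all but `ε` of the mass of `m`; since `(1 - φ) / q
    -- ≤ 1`, the error is at most `ε`.
    refine le_of_forall_pos_le_add fun ε hε => ?_
    obtain ⟨K, hK, hKε⟩ := exists_isCompact_measure_compl_le m hε
    obtain ⟨ψ, hψ, hψ0, hψ1, hψK⟩ := exists_smooth_bump_isCompact (d := d) hK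
    have h1 := hT.map_cutoff_le hφ ⟨ψ, hψ⟩ hψ1
    rw [hmT] at h1
    · have i1 : Integrable (fun τ => ψ τ * (1 - φ τ) / q τ) m := by
        refine (integrable_const (1 : ℝ)).mono' ?_ (.of_forall fun τ => ?_)
        · simp only [mul_div_assoc]
          exact (hψ.1.continuous.measurable.mul hkm).aestronglyMeasurable
        · rw [mul_div_assoc, Real.norm_eq_abs, abs_of_nonneg (mul_nonneg (hψ0 τ) (hk0 τ))]
          exact mul_le_one₀ (hψ1 τ) (hk0 τ) (hk1 τ)
      have i2 : Integrable (Kᶜ.indicator fun _ => (1 : ℝ)) m :=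
        (integrable_const 1).indicator hK.measurableSet.compl
      calc ∫ τ, (1 - φ τ) / q τ ∂m
          ≤ ∫ τ, (ψ τ * (1 - φ τ) / q τ + Kᶜ.indicator (fun _ => (1 : ℝ)) τ) ∂m := by
            refine integral_mono_of_nonneg (.of_forall hk0) (i1.add i2) (.of_forall fun τ => ?_)
            by_cases hτ : τ ∈ K
            · simp [hτ, hψK τ hτ]
            · have := mul_nonneg (hψ0 τ) (hk0 τ)
              simp only [indicator, mem_compl_iff, hτ, not_false_iff, if_true, mul_div_assoc]
              linarith [hk1 τ]
        _ = ∫ τ, ψ τ * (1 - φ τ) / q τ ∂m + m.real Kᶜ := by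
            rw [integral_add i1 i2, integral_indicator_const _ hK.measurableSet.compl]
            simp
        _ ≤ _ := add_le_add h1 hKε
    · filter_upwards [hφ.eventually_eq_one] with τ hτ
      change ψ τ * (1 - φ τ) = 0
      rw [hτ, sub_self, mul_zero]

end PositiveMaximumAtOne

end PositiveMaximumPrincipleAtOne

/-! ### The Lévy integral, and the difference between it and the functional. -/

section LevyFunctional

open Filter Topology

/-- Dominated convergence: the sets `{q < 1/(n+1)}` shrink to `{q = 0}`, where the integrand `q` is
itself `0`. -/
theorem exists_setIntegral_lt_le {G : Type*} [MeasurableSpace G] {ν : Measure G} {q : G → ℝ} (hqm : Measurable q) (hq0 : ∀ τ, 0 ≤ q τ)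
    (hq : Integrable q ν) {ε : ℝ} (hε : 0 < ε) :
    ∃ δ, 0 < δ ∧ ∫ τ, {τ | q τ < δ}.indicator q τ ∂ν ≤ ε := by
  have hms : ∀ δ, MeasurableSet {τ | q τ < δ} := fun δ => measurableSet_lt hqm measurable_const
  have hlim : Tendsto (fun n : ℕ => ∫ τ, {τ | q τ < 1 / ((n : ℝ) + 1)}.indicator q τ ∂ν) atTop
      (𝓝 (∫ _, (0 : ℝ) ∂ν)) := by
    refine tendsto_integral_of_dominated_convergence q
      (fun n => (hqm.indicator (hms _)).aestronglyMeasurable) hq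
      (fun n => .of_forall fun τ => ?_) (.of_forall fun τ => ?_)
    · rw [Real.norm_eq_abs, abs_of_nonneg (indicator_nonneg (fun τ _ => hq0 τ) τ)]
      exact indicator_le_self' (fun _ _ => hq0 _) τ
    · rcases (hq0 τ).eq_or_lt with h | h
      · have : ∀ n : ℕ, {τ | q τ < 1 / ((n : ℝ) + 1)}.indicator q τ = 0 := fun n =>
          indicator_apply_eq_zero.2 fun _ => h.symm
        simp only [this, tendsto_const_nhds]
      · refine tendsto_const_nhds.congr' ?_
        filter_upwards [(tendsto_one_div_add_atTop_nhds_zero_nat (𝕜 := ℝ)).eventually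
          (gt_mem_nhds h)] with n hn
        exact (indicator_of_notMem (s := {τ | q τ < 1 / ((n : ℝ) + 1)})
          (fun h' => lt_asymm hn h') q).symm
  rw [integral_zero] at hlim
  obtain ⟨n, hn⟩ := (hlim.eventually (gt_mem_nhds hε)).exists
  exact ⟨_, Nat.one_div_pos_of_nat, hn.le⟩

variable {d : ℕ} {G : Type*} [TopologicalSpace G] [ChartedSpace (EuclideanSpace ℝ (Fin d)) G]
  [Group G] [LieGroup (𝓡 d) ∞ G] [T2Space G] [MeasurableSpace G] [BorelSpace G]
  {X : Module.Basis (Fin d) ℝ (GroupLieAlgebra (𝓡 d) G)} {U : Set G} {x : Fin d → G → ℝ}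
  {φ : G → ℝ} {ν : Measure G}

/-- Integration of the first-order Taylor remainder against a Lévy measure, as a linear
functional. -/
noncomputable def levyIntegral (hx : IsCanonicalCoords X U x) (hν : IsLevyMeasure X ν) :
    smoothCompSupp d G →ₗ[ℝ] ℝ where
  toFun f := ∫ τ, ((f : G → ℝ) τ - (f : G → ℝ) 1 - ∑ i, x i τ * invDeriv (X i) f 1) ∂ν
  map_add' f g := by
    rw [← integral_add (hx.integrable_taylor_remainder hν f.2)
      (hx.integrable_taylor_remainder hν g.2)]
    refine integral_congr_ae (.of_forall fun τ => ?_)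
    have e : ∀ i, invDeriv (X i) ((f : G → ℝ) + (g : G → ℝ)) 1 =
      invDeriv (X i) f 1 + invDeriv (X i) g 1 := fun i => invDeriv_add (X i) f.2.1 g.2.1 1
    simp only [Submodule.coe_add, Pi.add_apply, e, mul_add, Finset.sum_add_distrib]
    ring
  map_smul' r f := by
    rw [RingHom.id_apply, smul_eq_mul, ← integral_const_mul]
    refine integral_congr_ae (.of_forall fun τ => ?_)
    have e : ∀ i, invDeriv (X i) (r • (f : G → ℝ)) 1 =
      r * invDeriv (X i) f 1 := fun i => invDeriv_const_mul (X i) r f.2.1 1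
    simp only [Submodule.coe_smul, Pi.smul_apply, smul_eq_mul, e, mul_sub, Finset.mul_sum,
      mul_left_comm]

theorem levyIntegral_eq_integral (hx : IsCanonicalCoords X U x) (hν : IsLevyMeasure X ν)
    {f : smoothCompSupp d G} (h0 : (f : G → ℝ) 1 = 0) (h1 : ∀ i, invDeriv (X i) f 1 = 0) :
    Integrable (f : G → ℝ) ν ∧ levyIntegral hx hν f = ∫ τ, (f : G → ℝ) τ ∂ν := by
  have := hx.integrable_taylor_remainder hν f.2
  simp only [h0, h1, mul_zero, Finset.sum_const_zero, sub_zero] at this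
  refine ⟨this, ?_⟩
  change ∫ τ, ((f : G → ℝ) τ - (f : G → ℝ) 1 - ∑ i, x i τ * invDeriv (X i) f 1) ∂ν = _
  simp only [h0, h1, mul_zero, Finset.sum_const_zero, sub_zero]

/-- A functional `T` satisfying the positive maximum principle at the neutral element, with its
Lévy measure. -/
structure IsLevyPart (T : smoothCompSupp d G →ₗ[ℝ] ℝ) (x : Fin d → G → ℝ) (φ : G → ℝ)
    (ν : Measure G) : Prop where
  positiveMaximum : PositiveMaximumAtOne T
  integrable : Integrable (coordWeight x φ) ν
  map_eq : ∀ h : smoothCompSupp d G, (∀ᶠ τ in 𝓝 1, (h : G → ℝ) τ = 0) →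
    T h = ∫ τ, (h : G → ℝ) τ ∂ν

namespace IsLevyPart

variable {T : smoothCompSupp d G →ₗ[ℝ] ℝ}

theorem map_eq_levyIntegral (hT : IsLevyPart T x φ ν) (hx : IsCanonicalCoords X U x)
    (hν : IsLevyMeasure X ν) {h : smoothCompSupp d G} (h0 : ∀ᶠ τ in 𝓝 1, (h : G → ℝ) τ = 0) :
    T h = levyIntegral hx hν h := by
  rw [hT.map_eq h h0, (levyIntegral_eq_integral hx hν h0.self_of_nhds fun i =>
    hx.invDeriv_eq_zero h.2 (C := 0) (h0.mono fun τ hτ => by simp [hτ]) i).2]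

/-- Split `f = f χ + f (1 - χ)` with `χ` a cut-off at `1` supported where `q < δ`. The functional
equals the `ν`-integral on the second part and is non-negative on the first, whose `ν`-integral is
arbitrarily small because `f ≤ C q`. -/
theorem levyIntegral_le_map (hT : IsLevyPart T x φ ν) (hx : IsCanonicalCoords X U x)
    (hφ : IsCutoff d φ U) (hν : IsLevyMeasure X ν) {f : smoothCompSupp d G}
    (h0 : ∀ τ, 0 ≤ (f : G → ℝ) τ) (h1 : (f : G → ℝ) 1 = 0) :
    levyIntegral hx hν f ≤ T f := by
  have hq0 := coordWeight_nonneg (x := x) hφ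
  have hqc := (hx.contMDiff_coordWeight hφ).continuous
  obtain ⟨hfi, hfe⟩ := levyIntegral_eq_integral hx hν h1
    fun i => invDeriv_eq_zero_of_forall_ge (X i) f.2.1 fun τ => h1 ▸ h0 τ
  obtain ⟨C, hC0, hC⟩ := hx.exists_le_mul_coordWeight hφ f.2 h0 h1
  rw [hfe]
  refine le_of_forall_pos_le_add fun ε hε => ?_
  -- Dividing by `C + 1` rather than `C` covers `C = 0`.
  obtain ⟨δ, hδ, hδε⟩ := exists_setIntegral_lt_le hqc.measurable hq0 hT.integrable
    (ε := ε / (C + 1)) (by positivity)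
  have hO : {τ | coordWeight x φ τ < δ} ∈ 𝓝 (1 : G) :=
    (isOpen_lt hqc continuous_const).mem_nhds (by simpa [hx.coordWeight_one hφ] using hδ)
  obtain ⟨χ, hχ⟩ := exists_isCutoff (d := d) hO
  let f1 := smoothCompSuppMul χ hχ.mem.1 f
  let f2 := smoothCompSuppMul (fun τ => 1 - χ τ) (contMDiff_const.sub hχ.mem.1) f
  have hf : f = f1 + f2 := Subtype.ext (funext fun τ => by
    change (f : G → ℝ) τ = (f : G → ℝ) τ * χ τ + (f : G → ℝ) τ * (1 - χ τ); ring)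
  have hT1 : 0 ≤ T f1 := hT.positiveMaximum.map_nonneg (fun τ => mul_nonneg (h0 τ) (hχ.nonneg τ))
    (by change (f : G → ℝ) 1 * χ 1 = 0; rw [h1, zero_mul])
  have hT2 : T f2 = ∫ τ, (f2 : G → ℝ) τ ∂ν := hT.map_eq f2 (by
    filter_upwards [hχ.eventually_eq_one] with τ hτ
    change (f : G → ℝ) τ * (1 - χ τ) = 0
    rw [hτ, sub_self, mul_zero])
  have hi1 : Integrable (f1 : G → ℝ) ν := by
    refine hfi.mono' f1.2.1.continuous.measurable.aestronglyMeasurable (.of_forall fun τ => ?_)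
    change ‖(f : G → ℝ) τ * χ τ‖ ≤ _
    rw [Real.norm_eq_abs, abs_of_nonneg (mul_nonneg (h0 τ) (hχ.nonneg τ))]
    exact mul_le_of_le_one_right (h0 τ) (hχ.le_one τ)
  have hi2 : Integrable (f2 : G → ℝ) ν := by
    refine hfi.mono' f2.2.1.continuous.measurable.aestronglyMeasurable (.of_forall fun τ => ?_)
    change ‖(f : G → ℝ) τ * (1 - χ τ)‖ ≤ _
    rw [Real.norm_eq_abs, abs_of_nonneg (mul_nonneg (h0 τ) (sub_nonneg.2 (hχ.le_one τ)))]
    exact mul_le_of_le_one_right (h0 τ) (by linarith [hχ.nonneg τ])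
  have hsmall : ∫ τ, (f1 : G → ℝ) τ ∂ν ≤ ε := by
    calc ∫ τ, (f1 : G → ℝ) τ ∂ν
        ≤ ∫ τ, C * {τ | coordWeight x φ τ < δ}.indicator (coordWeight x φ) τ ∂ν := by
          refine integral_mono hi1 ((hT.integrable.indicator
            (isOpen_lt hqc continuous_const).measurableSet).const_mul C) fun τ => ?_
          change (f : G → ℝ) τ * χ τ ≤ _
          by_cases hτ : τ ∈ {τ | coordWeight x φ τ < δ}
          · simp only [indicator_of_mem hτ]
            exact (mul_le_of_le_one_right (h0 τ) (hχ.le_one τ)).trans (hC τ)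
          · simp only [indicator_of_notMem hτ, mul_zero]
            rw [image_eq_zero_of_notMem_tsupport fun h => hτ (hχ.tsupport_subset h), mul_zero]
      _ ≤ C * (ε / (C + 1)) := by
          rw [integral_const_mul]; exact mul_le_mul_of_nonneg_left hδε hC0
      _ ≤ ε := by
          rw [← mul_div_assoc, div_le_iff₀ (by positivity)]; nlinarith
  have hsum : ∫ τ, (f : G → ℝ) τ ∂ν = ∫ τ, (f1 : G → ℝ) τ ∂ν + ∫ τ, (f2 : G → ℝ) τ ∂ν := by
    rw [← integral_add hi1 hi2]
    exact integral_congr_ae (.of_forall fun τ => congrFun (congrArg Subtype.val hf) τ)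
  rw [hsum, show T f = T f1 + T f2 by rw [← map_add, ← hf], hT2]
  linarith

/-- The difference of the two functionals is local: cutting off to the region where `f ≥ 0` changes
`f` only by a function vanishing near `1`, on which they agree. -/
theorem levyIntegral_le_map_of_eventually (hT : IsLevyPart T x φ ν)
    (hx : IsCanonicalCoords X U x) (hφ : IsCutoff d φ U) (hν : IsLevyMeasure X ν)
    {f : smoothCompSupp d G} (h0 : ∀ᶠ τ in 𝓝 1, 0 ≤ (f : G → ℝ) τ)
    (h1 : (f : G → ℝ) 1 = 0) : levyIntegral hx hν f ≤ T f := by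
  obtain ⟨χ, hχ⟩ := exists_isCutoff (d := d) h0
  let f1 := smoothCompSuppMul χ hχ.mem.1 f
  let f2 := smoothCompSuppMul (fun τ => 1 - χ τ) (contMDiff_const.sub hχ.mem.1) f
  have hf : f = f1 + f2 := Subtype.ext (funext fun τ => by
    change (f : G → ℝ) τ = (f : G → ℝ) τ * χ τ + (f : G → ℝ) τ * (1 - χ τ); ring)
  have e1 : levyIntegral hx hν f1 ≤ T f1 := by
    refine hT.levyIntegral_le_map hx hφ hν (fun τ => ?_) ?_
    · change 0 ≤ (f : G → ℝ) τ * χ τ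
      by_cases hτ : τ ∈ tsupport χ
      · exact mul_nonneg (hχ.tsupport_subset hτ) (hχ.nonneg τ)
      · rw [image_eq_zero_of_notMem_tsupport hτ, mul_zero]
    · change (f : G → ℝ) 1 * χ 1 = 0
      rw [h1, zero_mul]
  have e2 : T f2 = levyIntegral hx hν f2 := hT.map_eq_levyIntegral hx hν (by
    filter_upwards [hχ.eventually_eq_one] with τ hτ
    change (f : G → ℝ) τ * (1 - χ τ) = 0
    rw [hτ, sub_self, mul_zero])
  rw [hf, map_add, map_add, e2]
  linarith

/-- `T` and the integral against its Lévy measure agree on functions that vanish to third order. -/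
theorem map_eq_levyIntegral_of_cubic (hT : IsLevyPart T x φ ν) (hx : IsCanonicalCoords X U x)
    (hφ : IsCutoff d φ U) (hν : IsLevyMeasure X ν) {r : smoothCompSupp d G} {C : ℝ}
    (hr : ∀ᶠ τ in 𝓝 1, |(r : G → ℝ) τ| ≤ C * (∑ i, |x i τ|) * ∑ i, x i τ ^ 2) :
    T r = levyIntegral hx hν r := by
  let Q : smoothCompSupp d G := ⟨_, hx.sq_sum_mem_smoothCompSupp⟩
  have hQ1 : (Q : G → ℝ) 1 = 0 := by
    change ∑ i, x i 1 ^ 2 = 0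
    simp [hx.map_one]
  have hr1 : (r : G → ℝ) 1 = 0 := by
    simpa [hx.map_one] using hr.self_of_nhds
  have hsmall : ∀ ε > 0, ∀ᶠ τ in 𝓝 1, |(r : G → ℝ) τ| ≤ ε * (Q : G → ℝ) τ := by
    intro ε hε
    have hc : Continuous fun τ => C * ∑ i, |x i τ| :=
      continuous_const.mul (continuous_finsetSum _ fun i _ =>
        (hx.mem_smoothCompSupp i).1.continuous.abs)
    have h1 : ∀ᶠ τ in 𝓝 (1 : G), C * ∑ i, |x i τ| < ε :=
      hc.continuousAt.eventually (gt_mem_nhds (by simpa [hx.map_one] using hε))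
    filter_upwards [hr, h1] with τ h2 h3
    exact h2.trans (mul_le_mul_of_nonneg_right h3.le
      (Finset.sum_nonneg fun i _ => sq_nonneg _))
  have hQ0 : 0 ≤ T Q - levyIntegral hx hν Q := sub_nonneg.2 <|
    hT.levyIntegral_le_map hx hφ hν
      (fun τ => show 0 ≤ ∑ i, x i τ ^ 2 from Finset.sum_nonneg fun i _ => sq_nonneg _) hQ1
  -- Both `ε Q + r` and `ε Q - r` vanish at `1` and are non-negative near it.
  have key : ∀ ε > 0, |T r - levyIntegral hx hν r| ≤ ε * (T Q - levyIntegral hx hν Q) := by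
    intro ε hε
    have e1 := hT.levyIntegral_le_map_of_eventually hx hφ hν (f := ε • Q + r)
      ((hsmall ε hε).mono fun τ hτ => by
        change 0 ≤ ε * (Q : G → ℝ) τ + (r : G → ℝ) τ
        linarith [(abs_le.1 hτ).1])
      (by change ε * (Q : G → ℝ) 1 + (r : G → ℝ) 1 = 0; rw [hQ1, hr1]; ring)
    have e2 := hT.levyIntegral_le_map_of_eventually hx hφ hν (f := ε • Q - r)
      ((hsmall ε hε).mono fun τ hτ => by
        change 0 ≤ ε * (Q : G → ℝ) τ - (r : G → ℝ) τ
        linarith [(abs_le.1 hτ).2])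
      (by change ε * (Q : G → ℝ) 1 - (r : G → ℝ) 1 = 0; rw [hQ1, hr1]; ring)
    simp only [map_add, map_sub, map_smul, smul_eq_mul] at e1 e2
    rw [abs_le]
    constructor <;> linarith
  refine sub_eq_zero.1 (abs_nonpos_iff.1 (le_of_forall_pos_le_add fun ε hε => ?_))
  refine (key (ε / (T Q - levyIntegral hx hν Q + 1)) (by positivity)).trans ?_
  rw [zero_add, div_mul_eq_mul_div, div_le_iff₀ (by positivity)]
  nlinarith

end IsLevyPart

/-- The Courrège representation of a functional on `C_c^∞(G)` that satisfies the positive maximum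
principle at the neutral element. -/
theorem PositiveMaximumAtOne.exists_representation {T : smoothCompSupp d G →ₗ[ℝ] ℝ}
    (hT : PositiveMaximumAtOne T) (hx : IsCanonicalCoords X U x) :
    ∃ (c : ℝ) (b : Fin d → ℝ) (a : Matrix (Fin d) (Fin d) ℝ) (ν : Measure G),
      0 ≤ c ∧ a.PosSemidef ∧ IsLevyMeasure X ν ∧ ∀ f : smoothCompSupp d G,
        T f = -c * (f : G → ℝ) 1 + ∑ i, b i * invDeriv (X i) f 1
          + ∑ j, ∑ k, a j k * invDeriv (X j) (invDeriv (X k) f) 1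
          + ∫ τ, ((f : G → ℝ) τ - (f : G → ℝ) 1 - ∑ i, x i τ * invDeriv (X i) f 1) ∂ν := by
  obtain ⟨φ, hφ⟩ := exists_isCutoff (d := d) (hx.isOpen.mem_nhds hx.one_mem)
  obtain ⟨ν, hν1, hνq, hνT, hνφ⟩ := hT.exists_measure hx hφ
  have hν := hx.isLevyMeasure_of_integrable hφ hν1 hνq
  have hP : IsLevyPart T x φ ν := ⟨hT, hνq, hνT⟩
  let S := T - levyIntegral hx hν
  let Φ : smoothCompSupp d G := ⟨φ, hφ.mem⟩
  let x' : Fin d → smoothCompSupp d G := fun i => ⟨x i, hx.mem_smoothCompSupp i⟩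
  let xx : Fin d → Fin d → smoothCompSupp d G := fun j k =>
    ⟨fun τ => x j τ * x k τ, mul_mem_smoothCompSupp' (x' j).2 (x' k).2⟩
  -- Near `1` the cut-off `Φ` stands for the constant function `1`. The `1/2` is that of Taylor's
  -- formula, and symmetry of the matrix is that of the products `x_j x_k`.
  refine ⟨-S Φ, fun i => S (x' i), Matrix.of fun j k => S (xx j k) / 2, ν, ?_, ?_, hν,
    fun f => ?_⟩
  · have h1 : levyIntegral hx hν Φ = -∫ τ, (1 - φ τ) ∂ν := by
      rw [← integral_neg]
      refine integral_congr_ae (.of_forall fun τ => ?_)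
      have h2 : ∀ i, invDeriv (X i) φ 1 = 0 := fun i =>
        invDeriv_eq_zero_of_forall_le (X i) hφ.mem.1 fun τ => by
          rw [hφ.eventually_eq_one.self_of_nhds]; exact hφ.le_one τ
      simp [Φ, h2, hφ.eventually_eq_one.self_of_nhds]
    change 0 ≤ -(T Φ - levyIntegral hx hν Φ)
    rw [h1]; linarith
  · refine Matrix.PosSemidef.of_dotProduct_mulVec_nonneg ?_ fun ξ => ?_
    · ext j k
      have : xx k j = xx j k := Subtype.ext (funext fun τ => mul_comm _ _)
      simp [this]
    · let F : smoothCompSupp d G := ∑ j, ∑ k, (ξ j * ξ k) • xx j k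
      have hF : ∀ τ, (F : G → ℝ) τ = (∑ j, ξ j * x j τ) ^ 2 := fun τ => by
        simp only [F, xx, AddSubmonoidClass.coe_finsetSum, Finset.sum_apply, Submodule.coe_smul,
          Pi.smul_apply, smul_eq_mul, pow_two, Finset.sum_mul_sum]
        exact Finset.sum_congr rfl fun j _ => Finset.sum_congr rfl fun k _ => by ring
      have h1 : 0 ≤ S F := sub_nonneg.2 <| hP.levyIntegral_le_map hx hφ hν
        (fun τ => by rw [hF]; positivity) (by rw [hF]; simp [hx.map_one])
      have h2 : S F = ∑ j, ∑ k, ξ j * ξ k * S (xx j k) := by simp [F]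
      rw [h2] at h1
      have h3 : star ξ ⬝ᵥ (Matrix.of fun j k => S (xx j k) / 2).mulVec ξ =
          (∑ j, ∑ k, ξ j * ξ k * S (xx j k)) / 2 := by
        simp only [dotProduct, Matrix.mulVec, Matrix.of_apply, Finset.mul_sum, Finset.sum_div,
          star_trivial]
        exact Finset.sum_congr rfl fun j _ => Finset.sum_congr rfl fun k _ => by ring
      rw [h3]; positivity
  · let r : smoothCompSupp d G := f - (f : G → ℝ) 1 • Φ - ∑ i, invDeriv (X i) f 1 • x' i
      - ∑ j, ∑ k, (invDeriv (X j) (invDeriv (X k) f) 1 / 2) • xx j k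
    obtain ⟨C, -, hC⟩ := hx.exists_taylor_two f.2
    have hr : S r = 0 := sub_eq_zero.2 <| hP.map_eq_levyIntegral_of_cubic hx hφ hν (C := C) (by
      filter_upwards [hφ.eventually_eq_one, hx.isOpen.mem_nhds hx.one_mem] with τ h1 h2
      refine le_trans (le_of_eq (congrArg abs ?_)) (hC τ h2)
      simp only [r, Φ, x', xx, AddSubgroupClass.coe_sub, AddSubmonoidClass.coe_finsetSum,
        Finset.sum_apply, Submodule.coe_smul, Pi.smul_apply, Pi.sub_apply, smul_eq_mul, h1,
        mul_one, Finset.sum_div]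
      congr 1
      · congr 1
        exact Finset.sum_congr rfl fun i _ => mul_comm _ _
      · exact Finset.sum_congr rfl fun j _ => Finset.sum_congr rfl fun k _ => by ring)
    have hS : S f = (f : G → ℝ) 1 * S Φ + ∑ i, invDeriv (X i) f 1 * S (x' i)
        + ∑ j, ∑ k, invDeriv (X j) (invDeriv (X k) f) 1 / 2 * S (xx j k) := by
      simp only [r, map_sub, map_sum, map_smul, smul_eq_mul] at hr
      linarith
    have hTf : T f = S f + levyIntegral hx hν f := by simp [S]
    rw [hTf, hS]
    change _ + ∫ τ, ((f : G → ℝ) τ - (f : G → ℝ) 1 - ∑ i, x i τ * invDeriv (X i) f 1) ∂ν = _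
    congr 1
    congr 1
    · congr 1
      · ring
      · exact Finset.sum_congr rfl fun i _ => mul_comm _ _
    · refine Finset.sum_congr rfl fun j _ => Finset.sum_congr rfl fun k _ => ?_
      simp only [Matrix.of_apply]; ring

end LevyFunctional

/-! ### Translation to an arbitrary point, and the sign of the second-order part. -/

section GeneralisedCourrege

variable {d : ℕ} {G : Type*} [TopologicalSpace G] [ChartedSpace (EuclideanSpace ℝ (Fin d)) G]
  [Group G] [LieGroup (𝓡 d) ∞ G]

/-- Left translation by `σ`, as a linear endomorphism of `C_c^∞(G)`. -/
def smoothCompSuppTranslate (σ : G) : smoothCompSupp d G →ₗ[ℝ] smoothCompSupp d G where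
  toFun f := ⟨fun τ => (f : G → ℝ) (σ * τ), comp_mul_left_mem_smoothCompSupp f.2 σ⟩
  map_add' _ _ := rfl
  map_smul' _ _ := rfl

theorem invDeriv_translate (v : GroupLieAlgebra (𝓡 d) G) (σ : G) (f : smoothCompSupp d G) :
    invDeriv v (smoothCompSuppTranslate σ f : smoothCompSupp d G) 1 = invDeriv v f σ := by
  change invDeriv v (fun τ => (f : G → ℝ) (σ * τ)) 1 = _
  rw [invDeriv_comp_mul_left v f.2.1]
  simp only [mul_one]

theorem invDeriv_invDeriv_translate (v w : GroupLieAlgebra (𝓡 d) G) (σ : G)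
    (f : smoothCompSupp d G) :
    invDeriv v (invDeriv w (smoothCompSuppTranslate σ f : smoothCompSupp d G)) 1 =
      invDeriv v (invDeriv w f) σ := by
  change invDeriv v (invDeriv w (fun τ => (f : G → ℝ) (σ * τ))) 1 = _
  rw [invDeriv_comp_mul_left w f.2.1,
    invDeriv_comp_mul_left v (contMDiff_invDeriv w f.2.1)]
  simp only [mul_one]

theorem PositiveMaximumPrinciple.positiveMaximumAtOne
    {A : smoothCompSupp d G →ₗ[ℝ] (G → ℝ)} (hA : PositiveMaximumPrinciple A) (σ : G) :
    PositiveMaximumAtOne (LinearMap.proj σ ∘ₗ A ∘ₗ smoothCompSuppTranslate σ⁻¹) := by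
  intro f h1 h2
  have e : (f : G → ℝ) (σ⁻¹ * σ) = (f : G → ℝ) 1 := by rw [inv_mul_cancel]
  exact hA (smoothCompSuppTranslate σ⁻¹ f) σ (fun τ => (h1 _).trans_eq e.symm) (h2.trans_eq e.symm)

variable [T2Space G]

open scoped MatrixOrder in
-- Writing `a = B* B` turns the operator into `∑_l Y_l²` with `Y_l = ∑ᵢ B_{li} Xᵢ`, and each `Y_l²
-- f` is a second derivative along a one-parameter subgroup at a maximum.
theorem sum_mul_invDeriv_invDeriv_nonpos (X : Fin d → GroupLieAlgebra (𝓡 d) G)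
    {a : Matrix (Fin d) (Fin d) ℝ} (ha : a.PosSemidef) {f : G → ℝ}
    (hf : f ∈ smoothCompSupp d G) (h : ∀ τ, f τ ≤ f 1) :
    ∑ j, ∑ k, a j k * invDeriv (X j) (invDeriv (X k) f) 1 ≤ 0 := by
  obtain ⟨B, rfl⟩ := CStarAlgebra.nonneg_iff_eq_star_mul_self.1 ha.nonneg
  have key : ∀ l, ∑ j, ∑ k, B l j * B l k * invDeriv (X j) (invDeriv (X k) f) 1 ≤ 0 := by
    intro l
    have h1 := invDeriv_invDeriv_nonpos_of_forall_le (∑ i, B l i • X i) hf.1 h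
    rw [invDeriv_invDeriv_sum_smul X (B l) _ hf] at h1
    refine le_trans (le_of_eq ?_) h1
    change _ = ∑ k, _
    rw [Finset.sum_comm]
    refine Finset.sum_congr rfl fun k _ => ?_
    rw [invDeriv_sum_smul_vector, Finset.mul_sum]
    exact Finset.sum_congr rfl fun j _ => by ring
  refine le_trans (le_of_eq ?_) (Finset.sum_nonpos fun l (_ : l ∈ Finset.univ) => key l)
  symm
  rw [Finset.sum_comm]
  refine Finset.sum_congr rfl fun j _ => ?_
  rw [Finset.sum_comm]
  refine Finset.sum_congr rfl fun k _ => ?_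
  simp [Matrix.mul_apply, Finset.sum_mul, Matrix.star_eq_conjTranspose]

end GeneralisedCourrege

/-! ### The generalised Courrège theorem. -/

theorem mainTheorem1 {d : ℕ} {G : Type*} [TopologicalSpace G] [T2Space G]
    [ChartedSpace (EuclideanSpace ℝ (Fin d)) G] [Group G] [LieGroup (𝓡 d) ∞ G]
    [MeasurableSpace G] [BorelSpace G]
    (X : Module.Basis (Fin d) ℝ (GroupLieAlgebra (𝓡 d) G))
    (U : Set G) (x : Fin d → G → ℝ) (hx : IsCanonicalCoords X U x) :
    (∀ ν : Measure G, IsLevyMeasure X ν → ∀ (f : smoothCompSupp d G) (σ : G),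
      Integrable (fun τ => (f : G → ℝ) (σ * τ) - (f : G → ℝ) σ
        - ∑ i, x i τ * invDeriv (X i) f σ) ν) ∧
    ∀ A : smoothCompSupp d G →ₗ[ℝ] (G → ℝ),
      PositiveMaximumPrinciple A ↔
        ∃ (c : G → ℝ) (b : G → Fin d → ℝ) (a : G → Matrix (Fin d) (Fin d) ℝ)
          (μ : G → Measure G),
          (∀ σ, 0 ≤ c σ) ∧ (∀ σ, (a σ).PosSemidef) ∧ (∀ σ, IsLevyMeasure X (μ σ)) ∧
          ∀ (f : smoothCompSupp d G) (σ : G),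
            A f σ = -c σ * (f : G → ℝ) σ
              + ∑ i, b σ i * invDeriv (X i) f σ
              + ∑ j, ∑ k, a σ j k * invDeriv (X j) (invDeriv (X k) f) σ
              + ∫ τ, ((f : G → ℝ) (σ * τ) - (f : G → ℝ) σ
                  - ∑ i, x i τ * invDeriv (X i) f σ) ∂(μ σ) := by
  have value_translate : ∀ (σ : G) (f : smoothCompSupp d G) (τ : G),
      (smoothCompSuppTranslate σ f : G → ℝ) τ = (f : G → ℝ) (σ * τ) := fun _ _ _ => rfl
  refine ⟨fun ν hν f σ => ?_, fun A => ⟨fun hA => ?_, ?_⟩⟩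
  · have := hx.integrable_taylor_remainder hν (smoothCompSuppTranslate σ f).2
    simpa only [invDeriv_translate, value_translate, mul_one] using this
  · choose c b a μ hc ha hμ h using fun σ =>
      (hA.positiveMaximumAtOne σ).exists_representation hx
    refine ⟨c, b, a, μ, hc, ha, hμ, fun f σ => ?_⟩
    have h1 := h σ (smoothCompSuppTranslate σ f)
    have e : smoothCompSuppTranslate σ⁻¹ (smoothCompSuppTranslate σ f) = f :=
      Subtype.ext (funext fun τ => by simp only [value_translate, mul_inv_cancel_left])
    simp only [LinearMap.comp_apply, e, LinearMap.proj_apply, invDeriv_translate,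
      invDeriv_invDeriv_translate, value_translate, mul_one] at h1
    exact h1
  · rintro ⟨c, b, a, μ, hc, ha, -, h⟩ f ρ hmax h0
    have hmax' : ∀ τ, (smoothCompSuppTranslate ρ f : G → ℝ) τ ≤
        (smoothCompSuppTranslate ρ f : G → ℝ) 1 := fun τ => by
      simpa only [value_translate, mul_one] using hmax (ρ * τ)
    have h1 : ∀ i, invDeriv (X i) f ρ = 0 := fun i => by
      rw [← invDeriv_translate]
      exact invDeriv_eq_zero_of_forall_le _ (smoothCompSuppTranslate ρ f).2.1 hmax'
    have h2 := sum_mul_invDeriv_invDeriv_nonpos X (ha ρ) (smoothCompSuppTranslate ρ f).2 hmax'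
    simp only [invDeriv_invDeriv_translate] at h2
    -- With the first derivatives zero, the integrand is `f (ρ τ) - f ρ`, which is non-positive at a
    -- maximum.
    have h3 : ∫ τ, ((f : G → ℝ) (ρ * τ) - (f : G → ℝ) ρ
        - ∑ i, x i τ * invDeriv (X i) f ρ) ∂(μ ρ) ≤ 0 :=
      integral_nonpos fun τ => by
        change _ ≤ (0 : ℝ)
        simpa only [h1, mul_zero, Finset.sum_const_zero, sub_zero] using sub_nonpos.2 (hmax (ρ * τ))
    have h4 : 0 ≤ c ρ * (f : G → ℝ) ρ := mul_nonneg (hc ρ) h0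
    rw [h f ρ]
    simp only [h1, mul_zero, Finset.sum_const_zero, sub_zero] at h3 ⊢
    linarith
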